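/- Let $\phi_n$, $n\in\mathbb Z$, be neutral fermions, $\phi_m\phi_n+\phi_n\phi_m=(-1)^m\delta_{m,-n}$, acting on the Fock space with basis $\phi_{n_1}\cdots\phi_{n_k}|0\rangle$, $n_1>\dots>n_k\ge 0$, with vacua satisfying $\phi_m|0\rangle=0$ for $m<0$, $\langle 0|\phi_m=0$ for $m>0$, $\langle 0|0\rangle=1$, $\langle 0|\phi_0|0\rangle=0$. Let $r:\mathbb Z\to\mathbb C$ satisfy $r(n)=r(1-n)$, and for odd $k\ge 1$ put $$H_k=\tfrac12\sum_{n\in\mathbb Z}(-1)^{n+1}\phi_n\phi_{-k-n},\qquad B_k=\tfrac12\sum_{n\in\mathbb Z}(-1)^n\phi_n\phi_{k-n}\,r(n)r(n-1)\cdots r(n-k+1).$$ Write $\tfrac{\gamma}{2}=(\tfrac{\gamma_1}{2},\tfrac{\gamma_3}{2},\dots)$, and let $Q_\lambda=Q_\lambda(\tfrac\gamma2)$ be the projective Schur functions of the strict partitions $\lambda=(n_1>\dots>n_l>0)$ (including $\lambda=0$): $Q_\lambda$ is the Pfaffian of $(Q_{(n_i,n_j)})$, where a part $0$ is appended to $\lambda$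 if $l$ is odd, $Q_{(m,n)}=q_mq_n+2\sum_{i=1}^n(-1)^iq_{m+i}q_{n-i}$ for $m>n\ge0$, and $\sum_k q_kz^k=\exp\big(\sum_{n\text{ odd}}\gamma_nz^n\big)$. Let $l(\lambda)=l$ and $r_\lambda=\prod_{i}r(1)r(2)\cdots r(n_i)$. Then the $H_k$ commute with each other, the $B_k$ commute with each other, and there is exactly one bilinear form $\langle\cdot,\cdot\rangle_r$ on $\mathbb C[\gamma_1,\gamma_3,\dots]$ with $$\langle Q_\mu,Q_\lambda\rangle_r=2^{l(\lambda)}r_\lambda\delta_{\mu\lambda}\qquad\text{for all strict partitions }\mu,\lambda .$$ For all polynomials $f=f(\tfrac\gamma2)$, $g=g(\tfrac\gamma2)$ it satisfies $$\langle f,g\rangle_r=\langle 0|\,f\big(\tfrac{\mathbf H}2\big)\,g\big(-\tfrac{\mathbf B}2\big)|0\rangle,\qquad \tfrac{\mathbf H}2=\big(\tfrac{H_1}1,\tfrac{H_3}3,\tfrac{H_5}5,\dots\big),\quad \tfrac{\mathbf B}2=\big(\tfrac{B_1}1,\tfrac{B_3}3,\tfrac{B_5}5,\dots\big),$$ where $f(\tfrac{\mathbf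 H}2)$ is obtained by substituting $\tfrac{H_n}{n}$ for $\tfrac{\gamma_n}2$, and $g(-\tfrac{\mathbf B}2)$ by substituting $-\tfrac{B_n}{n}$. Consequently, as formal power series in $\mathbf t=(t_1,t_3,\dots)$ and $\mathbf t^*=(t_1^*,t_3^*,\dots)$, $$\tau_r(\mathbf t,\mathbf t^*):=\langle 0|e^{\sum_{n\text{ odd}} t_nH_n}\,e^{-\sum_{n\text{ odd}} t^*_nB_n}|0\rangle=\Big\langle e^{\sum_{m\text{ odd}}\frac12mt_m\gamma_m},\ e^{\sum_{m\text{ odd}}\frac12mt^*_m\gamma_m}\Big\rangle_r ,$$ where $n,m$ run over the positive odd numbers and the form is extended coefficientwise to formal series in the parameters $\mathbf t,\mathbf t^*$. -/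

import Mathlib

noncomputable section

namespace BKP

/-! ### Fock space of neutral fermions -/

/-- The right Fock space, realized as the exterior algebra on `e₀, e₁, e₂, …` over `ℂ`; the vector
`φ_{n₁} ⋯ φ_{n_k} |0⟩` with `n₁ > ⋯ > n_k ≥ 0` is `e_{n₁} ∧ ⋯ ∧ e_{n_k}`. -/
abbrev Fock : Type := ExteriorAlgebra ℂ (ℕ →₀ ℂ)

/-- The generator `e_n` as an element of the Fock space. -/
def gen (n : ℕ) : Fock := ExteriorAlgebra.ι ℂ (Finsupp.single n (1 : ℂ))

/-- Exterior multiplication by `e_n`. -/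
def create (n : ℕ) : Module.End ℂ Fock := LinearMap.mulLeft ℂ (gen n)

/-- Contraction with the `n`-th coordinate functional (the odd derivation with `e_m ↦ δ_{n,m}`). -/
def annih (n : ℕ) : Module.End ℂ Fock :=
  CliffordAlgebra.contractLeft (Q := (0 : QuadraticForm ℂ (ℕ →₀ ℂ)))
    (Finsupp.lapply n : (ℕ →₀ ℂ) →ₗ[ℂ] ℂ)

/-- The neutral fermions `φ_n`, `n ∈ ℤ`. -/
def phi (n : ℤ) : Module.End ℂ Fock :=
  if 0 < n then create n.natAbs
  else if n < 0 then (-1 : ℂ) ^ n • annih n.natAbs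
  else create 0 + (1 / 2 : ℂ) • annih 0

/-- The right vacuum vector `|0⟩`. -/
def vac : Fock := 1

/-- The left vacuum vector `⟨0|`, as the functional on the Fock space that projects onto degree
`0`. -/
def leftVac : Fock →ₗ[ℂ] ℂ :=
  (ExteriorAlgebra.algebraMapInv : Fock →ₐ[ℂ] ℂ).toLinearMap

/-- The vacuum expectation value `⟨0| A |0⟩`. -/
def vev (A : Module.End ℂ Fock) : ℂ := leftVac (A vac)

theorem annih_gen_mul (m n : ℕ) (v : Fock) :
    annih m (gen n * v) = (if m = n then v else 0) - gen n * annih m v := by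
  have h := CliffordAlgebra.contractLeft_ι_mul (Q := (0 : QuadraticForm ℂ (ℕ →₀ ℂ)))
    (Finsupp.lapply m : (ℕ →₀ ℂ) →ₗ[ℂ] ℂ) (Finsupp.single n (1 : ℂ)) v
  refine h.trans ?_
  congr 1
  by_cases hmn : m = n
  · subst hmn; simp
  · simp [hmn]

theorem create_create (m n : ℕ) (v : Fock) :
    create m (create n v) + create n (create m v) = 0 := by
  have h : gen m * gen n + gen n * gen m = 0 := ExteriorAlgebra.ι_add_mul_swap _ _
  simp only [create, LinearMap.mulLeft_apply, ← mul_assoc, ← add_mul, h, zero_mul]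

theorem annih_annih (m n : ℕ) (v : Fock) :
    annih m (annih n v) + annih n (annih m v) = 0 := by
  have h : annih m (annih n v) = -annih n (annih m v) :=
    CliffordAlgebra.contractLeft_comm _ _ _
  rw [h, neg_add_cancel]

theorem annih_create (m n : ℕ) (v : Fock) :
    annih m (create n v) + create n (annih m v) = if m = n then v else 0 := by
  simp only [create, LinearMap.mulLeft_apply, annih_gen_mul, sub_add_cancel]

/-- The canonical anticommutation relations `φ_m φ_n + φ_n φ_m = (-1)^m δ_{m,-n}`. -/
theorem phi_anticomm (m n : ℤ) :
    phi m * phi n + phi n * phi m = if m = -n then (-1 : ℂ) ^ m • 1 else 0 := by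
  refine LinearMap.ext fun v => ?_
  have cc := fun a b => create_create a b v
  have aa := fun a b => annih_annih a b v
  have ac := fun a b => annih_create a b v
  have key : phi m (phi n v) + phi n (phi m v) = if m = -n then (-1 : ℂ) ^ m • v else 0 := by
    rcases lt_trichotomy m 0 with hm | rfl | hm <;> rcases lt_trichotomy n 0 with hn | rfl | hn
    · simp only [phi, hm, hn, not_lt.2 hm.le, not_lt.2 hn.le, if_true, if_false,
        LinearMap.smul_apply, map_smul, smul_smul, if_neg (show ¬ m = -n by omega)]
      rw [mul_comm ((-1 : ℂ) ^ n), ← smul_add, aa, smul_zero]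
    · have h := ac m.natAbs 0
      rw [if_neg (by omega)] at h
      simp only [phi, hm, not_lt.2 hm.le, lt_irrefl, if_true, if_false,
        LinearMap.smul_apply, LinearMap.add_apply, map_add, map_smul,
        if_neg (show ¬ m = -0 by omega)]
      linear_combination (norm := module) (-1 : ℂ) ^ m • h + ((-1 : ℂ) ^ m * (1 / 2)) • aa m.natAbs 0
    · have h := ac m.natAbs n.natAbs
      simp only [phi, hm, hn, not_lt.2 hm.le, if_true, if_false,
        LinearMap.smul_apply, map_smul, ← smul_add, h]
      by_cases e : m = -n
      · rw [if_pos (by omega), if_pos e]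
      · rw [if_neg (by omega), if_neg e, smul_zero]
    · have h := ac n.natAbs 0
      rw [if_neg (by omega)] at h
      simp only [phi, hn, not_lt.2 hn.le, lt_irrefl, if_true, if_false,
        LinearMap.smul_apply, LinearMap.add_apply, map_add, map_smul,
        if_neg (show ¬ (0 : ℤ) = -n by omega)]
      linear_combination (norm := module) (-1 : ℂ) ^ n • h + ((-1 : ℂ) ^ n * (1 / 2)) • aa n.natAbs 0
    · have h := ac 0 0
      rw [if_pos rfl] at h
      simp only [phi, lt_irrefl, if_false, LinearMap.smul_apply, LinearMap.add_apply, map_add,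
        map_smul, neg_zero, if_true, zpow_zero]
      linear_combination (norm := module) h + cc 0 0 + (1 / 4 : ℂ) • aa 0 0
    · have h := ac 0 n.natAbs
      rw [if_neg (by omega)] at h
      simp only [phi, hn, lt_irrefl, if_true, if_false,
        LinearMap.smul_apply, LinearMap.add_apply, map_add, map_smul,
        if_neg (show ¬ (0 : ℤ) = -n by omega)]
      linear_combination (norm := module) (1 / 2 : ℂ) • h + cc 0 n.natAbs
    · have h := ac n.natAbs m.natAbs
      simp only [phi, hm, hn, not_lt.2 hn.le, if_true, if_false,
        LinearMap.smul_apply, map_smul, ← smul_add, add_comm (create m.natAbs _), h]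
      by_cases e : m = -n
      · rw [if_pos (by omega), if_pos e, e, zpow_neg, ← inv_zpow, inv_neg, inv_one]
      · rw [if_neg (by omega), if_neg e, smul_zero]
    · have h := ac 0 m.natAbs
      rw [if_neg (by omega)] at h
      simp only [phi, hm, lt_irrefl, if_true, if_false,
        LinearMap.smul_apply, LinearMap.add_apply, map_add, map_smul,
        if_neg (show ¬ m = -0 by omega)]
      linear_combination (norm := module) (1 / 2 : ℂ) • h + cc 0 m.natAbs
    · simp only [phi, hm, hn, if_true, if_neg (show ¬ m = -n by omega)]
      exact cc _ _
  simp only [LinearMap.add_apply, Module.End.mul_apply, key]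
  split <;> simp

/-- `φ_m |0⟩ = 0` for `m < 0`. -/
theorem phi_vac (m : ℤ) (hm : m < 0) : phi m vac = 0 := by
  have h : annih m.natAbs vac = 0 := CliffordAlgebra.contractLeft_one _ _
  simp [phi, hm, not_lt.2 hm.le, h]

/-- `⟨0| φ_m = 0` for `m > 0`. -/
theorem leftVac_phi (m : ℤ) (hm : 0 < m) (v : Fock) : leftVac (phi m v) = 0 := by
  simp [phi, hm, leftVac, create, gen, ExteriorAlgebra.algebraMapInv]

/-- Every vector is annihilated by all but finitely many `φ_{-n}`, `n > 0`. -/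
theorem exists_annih_eq_zero (v : Fock) : ∃ N : ℕ, ∀ n, N ≤ n → annih n v = 0 := by
  induction v using CliffordAlgebra.left_induction with
  | algebraMap r => exact ⟨0, fun n _ => CliffordAlgebra.contractLeft_algebraMap _ _ _⟩
  | add x y hx hy =>
    obtain ⟨N, hN⟩ := hx
    obtain ⟨M, hM⟩ := hy
    refine ⟨max N M, fun n hn => ?_⟩
    rw [map_add, hN n (le_trans (le_max_left _ _) hn), hM n (le_trans (le_max_right _ _) hn),
      add_zero]
  | ι_mul x a hx =>
    obtain ⟨N, hN⟩ := hx
    refine ⟨max N (a.support.sup id + 1), fun n hn => ?_⟩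
    have ha : a n = 0 := by
      by_contra hne
      have h1 : n ≤ a.support.sup id :=
        Finset.le_sup (f := id) (Finsupp.mem_support_iff.2 hne)
      have h2 := le_trans (le_max_right _ _) hn
      omega
    have h := CliffordAlgebra.contractLeft_ι_mul (Q := (0 : QuadraticForm ℂ (ℕ →₀ ℂ)))
      (Finsupp.lapply n : (ℕ →₀ ℂ) →ₗ[ℂ] ℂ) a x
    refine h.trans ?_
    have h0 := hN n (le_trans (le_max_left _ _) hn)
    simp only [annih] at h0
    simp [ha, h0]

theorem exists_phi_eq_zero (v : Fock) : ∃ N : ℕ, ∀ n : ℤ, n < -(N : ℤ) → phi n v = 0 := by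
  obtain ⟨N, hN⟩ := exists_annih_eq_zero v
  refine ⟨N, fun n hn => ?_⟩
  have h1 : n < 0 := by omega
  simp [phi, h1, not_lt.2 h1.le, hN n.natAbs (by omega)]

/-- On every vector, only finitely many terms of `∑_n c(n) φ_n φ_{s-n}` with `s ≠ 0` are nonzero. -/
theorem finite_support_quadratic (c : ℤ → ℂ) (s : ℤ) (hs : s ≠ 0) (v : Fock) :
    (Function.support fun n : ℤ => c n • phi n (phi (s - n) v)).Finite := by
  obtain ⟨N, hN⟩ := exists_phi_eq_zero v
  refine (Set.finite_Icc (-(N : ℤ)) (s + N)).subset fun n hn => ?_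
  rw [Function.mem_support] at hn
  by_contra hmem
  apply hn
  rw [Set.mem_Icc, not_and_or, not_le, not_le] at hmem
  rcases hmem with h | h
  · have hac := congrArg (fun T : Module.End ℂ Fock => T v) (phi_anticomm n (s - n))
    rw [if_neg (by omega)] at hac
    simp only [LinearMap.add_apply, Module.End.mul_apply, LinearMap.zero_apply, hN n h, map_zero,
      add_zero] at hac
    rw [hac, smul_zero]
  · rw [hN (s - n) (by omega), map_zero, smul_zero]

/-- The operator `∑_{n ∈ ℤ} c(n) φ_n φ_{s-n}` for `s ≠ 0` (on each vector a finite sum). -/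
def quadratic (c : ℤ → ℂ) (s : ℤ) (hs : s ≠ 0) : Module.End ℂ Fock where
  toFun v := ∑ᶠ n : ℤ, c n • phi n (phi (s - n) v)
  map_add' v w := by
    simp only [map_add, smul_add]
    exact finsum_add_distrib (finite_support_quadratic c s hs v)
      (finite_support_quadratic c s hs w)
  map_smul' a v := by
    simp only [map_smul, RingHom.id_apply]
    rw [smul_finsum' a (finite_support_quadratic c s hs v)]
    exact finsum_congr fun n => smul_comm _ _ _

/-- The Hamiltonian `H_k = ½ ∑_n (-1)^(n+1) φ_n φ_{-k-n}` for the odd number `k = 2 i + 1`. -/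
def opH (i : ℕ) : Module.End ℂ Fock :=
  quadratic (fun n => 1 / 2 * (-1 : ℂ) ^ (n + 1)) (-(2 * (i : ℤ) + 1)) (by omega)

/-- The operator `B_k = ½ ∑_n (-1)^n φ_n φ_{k-n} r(n) r(n-1) ⋯ r(n-k+1)` for the odd number
`k = 2 i + 1`. -/
def opB (r : ℤ → ℂ) (i : ℕ) : Module.End ℂ Fock :=
  quadratic (fun n => 1 / 2 * (-1 : ℂ) ^ n * ∏ j ∈ Finset.range (2 * i + 1), r (n - (j : ℤ)))
    (2 * (i : ℤ) + 1) (by omega)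

/-! ### Polynomials, formal exponentials, projective Schur functions -/

/-- Polynomials in the variables `γ₁/2, γ₃/2, γ₅/2, …`: the variable `X i` is `γ_{2i+1}/2`. -/
abbrev Poly : Type := MvPolynomial ℕ ℂ

/-- The result of substituting the operators `T 0, T 1, …` for the variables of `f`. The factors of
a monomial are ordered by their index; the order is immaterial when the operators commute. -/
def evalOp (T : ℕ → Module.End ℂ Fock) (f : Poly) : Module.End ℂ Fock :=
  ∑ m ∈ f.support, f.coeff m • ((m.support.sort (· ≤ ·)).map fun i => T i ^ m i).prod

/-- The exponential `∑_j F^j / j!` of a formal power series `F` without constant term, with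
coefficients in a possibly noncommutative algebra (terms with `j > |α|` do not contribute to the
coefficient at `α`). -/
def formalExp {σ A : Type} [Ring A] [Algebra ℂ A] (F : MvPowerSeries σ A) : MvPowerSeries σ A :=
  fun α => ∑ j ∈ Finset.range (α.degree + 1),
    ((j.factorial : ℂ)⁻¹) • MvPowerSeries.coeff α (F ^ j)

open Classical in
/-- The linear formal series `∑_i t_i a_i` in the variables `t_0, t_1, …`. -/
def linSeries {A : Type} [Ring A] (a : ℕ → A) : MvPowerSeries ℕ A :=
  fun α => ∑ i ∈ α.support, if α = Finsupp.single i 1 then a i else 0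

/-- `ξ(γ, z) = ∑_{n odd} γ_n z^n`, where `γ_n = 2 · (γ_n/2)`. -/
def xi : PowerSeries Poly :=
  PowerSeries.mk fun n => if Odd n then 2 * MvPolynomial.X (n / 2) else 0

/-- `q_k(γ/2)`, defined by `∑_k q_k z^k = exp (∑_{n odd} γ_n z^n)`. -/
def q (k : ℕ) : Poly := PowerSeries.coeff k (formalExp xi : PowerSeries Poly)

/-- `Q_{(m,n)} = q_m q_n + 2 ∑_{i=1}^n (-1)^i q_{m+i} q_{n-i}`. -/
def q₂ (m n : ℕ) : Poly :=
  q m * q n + 2 * ∑ i ∈ Finset.Icc 1 n, (-1) ^ i * q (m + i) * q (n - i)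

/-- The Pfaffian of the skew-symmetric matrix with entries `A x y` above the diagonal (for `x`
preceding `y` in the list), by expansion along the first row. -/
def pfaffian {α R : Type} [CommRing R] (A : α → α → R) : List α → R
  | [] => 1
  | x :: l => ∑ i : Fin l.length, (-1) ^ (i : ℕ) * A x l[i] * pfaffian A (l.eraseIdx i)
  termination_by l => l.length
  decreasing_by
    have hi := i.isLt
    simp only [List.length_cons, List.length_eraseIdx]
    split <;> omega

/-- Strict partitions (including the empty one), as finite sets of positive integers. -/
abbrev StrictPartition : Type := {s : Finset ℕ // 0 ∉ s}

/-- The length `l(λ)`. -/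
def StrictPartition.length (lam : StrictPartition) : ℕ := lam.1.card

/-- The parts in decreasing order, with a part `0` appended when their number is odd. -/
def StrictPartition.evenParts (lam : StrictPartition) : List ℕ :=
  lam.1.sort (fun a b => a ≥ b) ++ (if Odd lam.1.card then [0] else [])

/-- The projective Schur function `Q_λ(γ/2)`: Schur's Pfaffian of the `Q_{(n_i,n_j)}`. -/
def projSchur (lam : StrictPartition) : Poly := pfaffian q₂ lam.evenParts

/-- `r_λ = ∏_i r(1) r(2) ⋯ r(n_i)`. -/
def rPart (r : ℤ → ℂ) (lam : StrictPartition) : ℂ :=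
  ∏ n ∈ lam.1, ∏ j ∈ Finset.Icc 1 n, r (j : ℤ)

/-- The bilinear form `b` is the deformed scalar product:
`⟨Q_μ, Q_λ⟩ = 2^{l(λ)} r_λ δ_{μ,λ}`. -/
def IsDeformedScalarProduct (r : ℤ → ℂ) (b : Poly →ₗ[ℂ] Poly →ₗ[ℂ] ℂ) : Prop :=
  ∀ mu lam : StrictPartition,
    b (projSchur mu) (projSchur lam) = if mu = lam then 2 ^ lam.length * rPart r lam else 0

/-- For `F = ∑_α t^α F_α` and `G = ∑_β t*^β G_β`, the formal series
`∑_{α,β} t^α t*^β p(F_α, G_β)` in the two families of variables. -/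
def pairSeries {A C : Type} [Ring A] [Ring C] (p : A → C → ℂ) (F : MvPowerSeries ℕ A)
    (G : MvPowerSeries ℕ C) : MvPowerSeries (ℕ ⊕ ℕ) ℂ :=
  fun κ => p (MvPowerSeries.coeff (κ.comapDomain Sum.inl Sum.inl_injective.injOn) F)
    (MvPowerSeries.coeff (κ.comapDomain Sum.inr Sum.inr_injective.injOn) G)

/-- `τ_r(t, t*) = ⟨0| e^{H(t)} e^{-B(t*)} |0⟩` with `H(t) = ∑ t_n H_n` and `B(t*) = ∑ t*_n B_n`, as a
formal power series in `t₁, t₃, …; t*₁, t*₃, …` (the `i`-th variable of a family is the one with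
subscript `2i+1`). -/
def tau (r : ℤ → ℂ) : MvPowerSeries (ℕ ⊕ ℕ) ℂ :=
  pairSeries (fun S T => vev (S * T)) (formalExp (linSeries opH))
    (formalExp (-linSeries (opB r)))

/-- `exp (∑_{m odd} ½ m t_m γ_m)` as a formal power series in `t` with coefficients in the
polynomials in `γ/2`. -/
def expSeries : MvPowerSeries ℕ Poly :=
  formalExp (linSeries fun i => (2 * (i : ℂ) + 1) • (MvPolynomial.X i : Poly))

/-- The family `H/2 = (H₁/1, H₃/3, H₅/5, …)`. -/
def halfH (i : ℕ) : Module.End ℂ Fock := (2 * (i : ℂ) + 1)⁻¹ • opH i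

/-- The family `B/2 = (B₁/1, B₃/3, B₅/5, …)`. -/
def halfB (r : ℤ → ℂ) (i : ℕ) : Module.End ℂ Fock := (2 * (i : ℂ) + 1)⁻¹ • opB r i

end BKP

end

noncomputable section

namespace BKP

/-! ### The monomial basis of the Fock space -/

/-! Write H_k for `opH` and A_k for `raise`, the operator -B_k at r = 1 (k odd). Their brackets with
φ_m are the index shifts φ_{m-k} and φ_{m+k}. An operator commuting with all fermions is determined
by its value on the vacuum (`eq_zero_of_commute`, `eq_zero_of_phi_neg`), so [H_k, A_l] = (k/2)
δ_{kl} reduces to a vacuum expectation. Hence f ↦ f(A_k/k)|0⟩ embeds the polynomials into the Fock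
space (`raiseHom`), with H_k acting as half the derivative in γ_k/2 (`opH_raiseHom`).

Three facts give the theorem. (a) The Fock space has a bilinear form with orthogonal monomials for
which H_k is adjoint to A_k (`form_raise`) and pairing with |0⟩ is ⟨0|. (b) The dilation D : e_n ↦
r(1)⋯r(n) e_n fixes |0⟩ and intertwines A_k with -B_k (`opB_dilate`); this uses r(n) = r(1-n). (c)
Q_λ goes to a power of 2 times the monomial of the parts of λ, padded by 0 to even number
(`raiseHom_projSchur`). By (c), ⟨f, g⟩ = (f(A_k/k)|0⟩, D g(A_k/k)|0⟩) takes the prescribed values on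
the Q_λ; by (a) and (b) it equals ⟨0| f(H/2) g(-B/2) |0⟩. The images of the Q_λ exhaust the even
part of the Fock space, so the Q_λ span and the form is unique. The formula for τ is the same
identity, coefficient by coefficient.

The work lies in (c). On odd vectors e_x acts as ∑_y ½ Q_{(x,y)} ι_y, up to a correction at x = y =
0 (`wickDefect_eq_zero`), and this expands a wedge as a Pfaffian is expanded along its first row.
The difference of the two sides is even, and by induction it is killed by ⟨0| and by all H_k. Such a
vector vanishes (`eq_zero_of_opH_eq_zero`): the Sugawara operator ∑ A_k H_k, a priori quartic in the
fermions, satisfies [S, φ_m] = (m/2) φ_m and so multiplies each monomial by half its weight. -/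

theorem create_apply (n : ℕ) (v : Fock) : create n v = gen n * v := rfl

theorem phi_natCast {n : ℕ} (hn : 0 < n) : phi (n : ℤ) = create n := by
  simp [phi, hn]

theorem phi_zero : phi 0 = create 0 + (1 / 2 : ℂ) • annih 0 := by simp [phi]

theorem phi_neg_natCast {n : ℕ} (hn : 0 < n) : phi (-(n : ℤ)) = (-1 : ℂ) ^ n • annih n := by
  simp [phi, hn, not_lt.2 (Int.natCast_nonneg n), ← inv_pow, inv_neg]

theorem phi_phi (m n : ℤ) (v : Fock) :
    phi m (phi n v) = (if m = -n then (-1 : ℂ) ^ m else 0) • v - phi n (phi m v) := by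
  have h := congrArg (fun T : Module.End ℂ Fock => T v) (phi_anticomm m n)
  simp only [LinearMap.add_apply, Module.End.mul_apply] at h
  rw [eq_sub_iff_add_eq, h]
  split <;> simp

theorem phi_phi_of_ne {m n : ℤ} (h : m + n ≠ 0) (v : Fock) :
    phi m (phi n v) = -phi n (phi m v) := by
  rw [phi_phi, if_neg (by omega), zero_smul, zero_sub]

theorem annih_vac (n : ℕ) : annih n vac = 0 := CliffordAlgebra.contractLeft_one _ _

theorem leftVac_vac : leftVac vac = 1 := by simp [leftVac, vac]

theorem leftVac_create (n : ℕ) (v : Fock) : leftVac (create n v) = 0 := by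
  simp [leftVac, create, gen, ExteriorAlgebra.algebraMapInv]

theorem fock_induction {P : Fock → Prop} (hvac : P vac) (hadd : ∀ v w, P v → P w → P (v + w))
    (hsmul : ∀ (a : ℂ) v, P v → P (a • v)) (hcreate : ∀ n v, P v → P (create n v)) (v : Fock) :
    P v := by
  induction v using CliffordAlgebra.left_induction with
  | algebraMap r => rw [Algebra.algebraMap_eq_smul_one]; exact hsmul r _ hvac
  | add x y hx hy => exact hadd _ _ hx hy
  | ι_mul x a hx =>
    induction a using Finsupp.induction_linear with
    | zero => simpa using hsmul 0 _ hvac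
    | add a b ha hb => rw [map_add, add_mul]; exact hadd _ _ ha hb
    | single n c =>
      have h : ((CliffordAlgebra.ι 0) (Finsupp.single n c) : Fock) * x = c • create n x := by
        have : Finsupp.single n c = c • Finsupp.single n (1 : ℂ) := by simp
        rw [this, map_smul, smul_mul_assoc]
        rfl
      rw [h]
      exact hsmul _ _ (hcreate _ _ hx)

/-- The product `e_{n₁} ∧ ⋯ ∧ e_{n_k}` of a list of generators. -/
def wedge (l : List ℕ) : Fock := (l.map gen).prod

theorem wedge_nil : wedge [] = vac := rfl

theorem wedge_cons (n : ℕ) (l : List ℕ) : wedge (n :: l) = create n (wedge l) := by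
  simp [wedge, create_apply]

theorem create_create_swap (m n : ℕ) (v : Fock) : create m (create n v) = -create n (create m v) :=
  eq_neg_of_add_eq_zero_left (create_create m n v)

theorem create_create_self (n : ℕ) (v : Fock) : create n (create n v) = 0 := by
  have h := create_create n n v
  rwa [← two_smul ℂ, smul_eq_zero_iff_right two_ne_zero] at h

/-- The scalar is a sign, left unspecified because only spans are at stake. -/
theorem wedge_perm {l l' : List ℕ} (h : l.Perm l') : ∃ c : ℂ, wedge l = c • wedge l' := by
  induction h with
  | nil => exact ⟨1, (one_smul _ _).symm⟩
  | cons x _ ih =>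
    obtain ⟨c, hc⟩ := ih
    exact ⟨c, by rw [wedge_cons, wedge_cons, hc, map_smul]⟩
  | swap x y l =>
    exact ⟨-1, by simp only [wedge_cons]; rw [create_create_swap, neg_one_smul]⟩
  | trans _ _ ih₁ ih₂ =>
    obtain ⟨c, hc⟩ := ih₁
    obtain ⟨d, hd⟩ := ih₂
    exact ⟨c * d, by rw [hc, hd, smul_smul]⟩

theorem wedge_of_duplicate {l : List ℕ} (h : ¬l.Nodup) : wedge l = 0 := by
  induction l with
  | nil => simp at h
  | cons x l ih =>
    by_cases hl : l.Nodup
    · have hx : x ∈ l := by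
        by_contra hx
        exact h (List.nodup_cons.2 ⟨hx, hl⟩)
      obtain ⟨c, hc⟩ := wedge_perm (List.perm_cons_erase hx)
      rw [wedge_cons, hc, wedge_cons, map_smul, create_create_self, smul_zero]
    · rw [wedge_cons, ih hl, map_zero]

/-- The basis vector `e_{n₁} ∧ ⋯ ∧ e_{n_k}`, `n₁ > ⋯ > n_k`, of a finite set. -/
def monomial (s : Finset ℕ) : Fock := wedge (s.sort (fun a b => a ≥ b))

theorem span_monomial : Submodule.span ℂ (Set.range monomial) = ⊤ := by
  have hw : ∀ l, wedge l ∈ Submodule.span ℂ (Set.range monomial) := by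
    intro l
    by_cases hl : l.Nodup
    · have hp : l.Perm (l.toFinset.sort (fun a b => a ≥ b)) := by
        refine (List.perm_ext_iff_of_nodup hl (Finset.sort_nodup _ _)).2 fun a => ?_
        simp
      obtain ⟨c, hc⟩ := wedge_perm hp
      rw [hc]
      exact Submodule.smul_mem _ _ (Submodule.subset_span ⟨_, rfl⟩)
    · rw [wedge_of_duplicate hl]
      exact Submodule.zero_mem _
  have hs : Submodule.span ℂ (Set.range wedge) ≤ Submodule.span ℂ (Set.range monomial) :=
    Submodule.span_le.2 (by rintro _ ⟨l, rfl⟩; exact hw l)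
  rw [eq_top_iff]
  intro v _
  apply hs
  induction v using fock_induction with
  | hvac => exact Submodule.subset_span ⟨[], rfl⟩
  | hadd v w hv hw => exact Submodule.add_mem _ (hv trivial) (hw trivial)
  | hsmul a v hv => exact Submodule.smul_mem _ _ (hv trivial)
  | hcreate n v hv =>
    have h : Submodule.span ℂ (Set.range wedge) ≤
        (Submodule.span ℂ (Set.range wedge)).comap (create n) :=
      Submodule.span_le.2 (by
        rintro _ ⟨l, rfl⟩
        exact Submodule.subset_span ⟨n :: l, wedge_cons n l⟩)
    exact h (hv trivial)

theorem exists_sum_monomial (v : Fock) : ∃ c : Finset ℕ →₀ ℂ, v = c.sum fun s a => a • monomial s := by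
  have h : v ∈ Submodule.span ℂ (Set.range monomial) := by rw [span_monomial]; trivial
  obtain ⟨c, hc⟩ := Finsupp.mem_span_range_iff_exists_finsupp.1 h
  exact ⟨c, hc.symm⟩

theorem monomial_induction {P : Fock → Prop} (hzero : P 0) (hadd : ∀ v w, P v → P w → P (v + w))
    (hsmul : ∀ (a : ℂ) v, P v → P (a • v)) (hmon : ∀ s, P (monomial s)) (v : Fock) : P v := by
  have h : v ∈ Submodule.span ℂ (Set.range monomial) := by rw [span_monomial]; trivial
  induction h using Submodule.span_induction with
  | mem x hx => obtain ⟨s, rfl⟩ := hx; exact hmon s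
  | zero => exact hzero
  | add x y _ _ hx hy => exact hadd _ _ hx hy
  | smul a x _ hx => exact hsmul _ _ hx

/-- The vector `e_{n₁} ∧ ⋯ ∧ e_{n_k}`, `n₁ > ⋯ > n_k`, is `φ_{n₁} ⋯ φ_{n_k} |0⟩`. -/
theorem wedge_cons_of_sorted {n : ℕ} {l : List ℕ} (h : (n :: l).Pairwise (· > ·)) :
    wedge (n :: l) = phi n (wedge l) := by
  rcases Nat.eq_zero_or_pos n with rfl | hn
  -- φ_0 differs from e_0 by ½ ι_0. In a strictly decreasing list 0 can only be the last entry, so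
  -- this extra term meets the vacuum.
  · have hl : l = [] := by
      rcases l with _ | ⟨x, l⟩
      · rfl
      · exact absurd ((List.pairwise_cons.1 h).1 x (by simp)) (by omega)
    subst hl
    simp [wedge_cons, wedge_nil, phi_zero, annih_vac]
  · rw [wedge_cons, phi_natCast hn]

theorem sort_pairwise_gt (s : Finset ℕ) : (s.sort (fun a b => a ≥ b)).Pairwise (· > ·) :=
  (Finset.sortedGT_sort s).pairwise

theorem wedge_sorted_induction {P : Fock → Prop} (hvac : P vac)
    (hphi : ∀ (n : ℕ) v, P v → P (phi n v)) {l : List ℕ} (h : l.Pairwise (· > ·)) :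
    P (wedge l) := by
  induction l with
  | nil => exact hvac
  | cons n l ih =>
    rw [wedge_cons_of_sorted h]
    exact hphi _ _ (ih (List.pairwise_cons.1 h).2)

/-- The fermions `φ_n`, `n ≥ 0`, generate the Fock space from the vacuum. -/
theorem phi_induction {P : Fock → Prop} (hvac : P vac) (hadd : ∀ v w, P v → P w → P (v + w))
    (hsmul : ∀ (a : ℂ) v, P v → P (a • v)) (hphi : ∀ (n : ℕ) v, P v → P (phi n v)) (v : Fock) :
    P v :=
  monomial_induction (by simpa using hsmul 0 _ hvac) hadd hsmul
    (fun s => wedge_sorted_induction hvac hphi (sort_pairwise_gt s)) v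

/-! ### Parity -/

/-- The parity automorphism, `(-1)^k` on products of `k` generators. -/
def parity : Module.End ℂ Fock :=
  (CliffordAlgebra.involute : CliffordAlgebra (0 : QuadraticForm ℂ (ℕ →₀ ℂ)) →ₐ[ℂ] _).toLinearMap

theorem parity_vac : parity vac = vac := map_one CliffordAlgebra.involute

theorem parity_create (n : ℕ) (v : Fock) : parity (create n v) = -create n (parity v) := by
  change CliffordAlgebra.involute (gen n * v) = -(gen n * CliffordAlgebra.involute v)
  rw [map_mul, ← neg_mul]
  congr 1
  exact CliffordAlgebra.involute_ι _

theorem annih_create_apply (m n : ℕ) (v : Fock) :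
    annih m (create n v) = (if m = n then v else 0) - create n (annih m v) :=
  annih_gen_mul m n v

theorem parity_annih (n : ℕ) (v : Fock) : parity (annih n v) = -annih n (parity v) := by
  induction v using fock_induction with
  | hvac => rw [annih_vac, parity_vac, annih_vac, map_zero, neg_zero]
  | hadd v w hv hw => simp only [map_add, hv, hw, neg_add]
  | hsmul a v hv => simp only [map_smul, hv, smul_neg]
  | hcreate m v hv =>
    simp only [annih_create_apply, map_sub, parity_create, hv, map_neg, neg_sub, neg_neg]
    split <;> simp

theorem parity_phi (n : ℤ) (v : Fock) : parity (phi n v) = -phi n (parity v) := by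
  rcases lt_trichotomy n 0 with h | rfl | h
  · lift -n to ℕ using by omega with m hm
    obtain rfl : n = -(m : ℤ) := by omega
    simp [phi_neg_natCast (show 0 < m by omega), parity_annih]
  · simp [phi_zero, parity_create, parity_annih, add_comm]
  · lift n to ℕ using h.le
    rw [phi_natCast (by omega), parity_create]

theorem leftVac_parity (v : Fock) : leftVac (parity v) = leftVac v := by
  induction v using fock_induction with
  | hvac => rw [parity_vac]
  | hadd v w hv hw => simp only [map_add, hv, hw]
  | hsmul a v hv => simp only [map_smul, hv]
  | hcreate m v hv => rw [parity_create, map_neg, leftVac_create, leftVac_create, neg_zero]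

theorem parity_wedge (l : List ℕ) : parity (wedge l) = (-1 : ℂ) ^ l.length • wedge l := by
  induction l with
  | nil => rw [wedge_nil, parity_vac, List.length_nil, pow_zero, one_smul]
  | cons n l ih =>
    rw [wedge_cons, parity_create, ih, map_smul, List.length_cons, pow_succ, mul_neg_one, neg_smul]

/-! ### The invariant bilinear form on the Fock space -/

/-- The norm of `e_n`: `½` for `n = 0` and `1` for `n > 0`. -/
def genNorm (n : ℕ) : ℂ := if n = 0 then 1 / 2 else 1

theorem genNorm_ne_zero (n : ℕ) : genNorm n ≠ 0 := by
  unfold genNorm; split <;> norm_num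

/-- The functionals `genNorm n • e_n^*`, depending linearly on `e_n`. -/
def dualGen : (ℕ →₀ ℂ) →ₗ[ℂ] Module.Dual ℂ (ℕ →₀ ℂ) :=
  Finsupp.linearCombination ℂ fun n => genNorm n • (Finsupp.lapply n : (ℕ →₀ ℂ) →ₗ[ℂ] ℂ)

/-- The algebra antihomomorphism that sends `e_n` to the contraction `genNorm n • annih n`. -/
def adjointHom : Fock →ₐ[ℂ] (Module.End ℂ Fock)ᵐᵒᵖ :=
  ExteriorAlgebra.lift ℂ ⟨(MulOpposite.opLinearEquiv ℂ).toLinearMap ∘ₗ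
    (CliffordAlgebra.contractLeft (Q := (0 : QuadraticForm ℂ (ℕ →₀ ℂ)))) ∘ₗ dualGen, fun m => by
      rw [← MulOpposite.unop_inj]
      refine LinearMap.ext fun v => ?_
      -- The universal property asks that degree-one vectors go to elements of square zero, and
      -- contracting twice with the same functional gives zero.
      exact CliffordAlgebra.contractLeft_contractLeft _ _⟩

theorem adjointHom_gen (n : ℕ) : (adjointHom (gen n)).unop = genNorm n • annih n := by
  have h : adjointHom (gen n) = _ := ExteriorAlgebra.lift_ι_apply ..
  rw [h]
  simp [dualGen, annih]

/-- The bilinear form on the Fock space with `(|0⟩, v) = ⟨0|v` for which `(-1)^m φ_{-m}` is the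
adjoint of `φ_m`. -/
def form : Fock →ₗ[ℂ] Fock →ₗ[ℂ] ℂ :=
  LinearMap.mk₂ ℂ (fun u v => leftVac ((adjointHom u).unop v)) (by simp) (by simp) (by simp)
    (by simp)

theorem form_vac (v : Fock) : form vac v = leftVac v := by
  simp [form, vac]

theorem form_create (n : ℕ) (u v : Fock) :
    form (create n u) v = genNorm n * form u (annih n v) := by
  simp only [form, LinearMap.mk₂_apply, create_apply, map_mul, MulOpposite.unop_mul, adjointHom_gen,
    Module.End.mul_apply, LinearMap.smul_apply, map_smul, smul_eq_mul]

theorem form_annih (n : ℕ) (u v : Fock) :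
    genNorm n * form (annih n u) v = form u (create n v) := by
  induction u using fock_induction generalizing v with
  | hvac => rw [annih_vac, form_vac, leftVac_create, map_zero, LinearMap.zero_apply, mul_zero]
  | hadd u w hu hw => simp only [map_add, LinearMap.add_apply, mul_add, hu, hw]
  | hsmul a u hu =>
    simp only [map_smul, LinearMap.smul_apply, smul_eq_mul, ← hu]; ring
  | hcreate m u hu =>
    rw [annih_create_apply, form_create, annih_create_apply, map_sub, map_sub, ← hu,
      LinearMap.sub_apply, form_create]
    by_cases h : n = m
    · subst h; simp
    · simp [h, Ne.symm h]; ring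

/-- The norm ½ of e_0 is what makes this hold at m = 0: the adjoint of e_0 is then ½ ι_0, so their
sum φ_0 is self-adjoint. -/
theorem form_phi (m : ℤ) (u v : Fock) : form (phi m u) v = (-1 : ℂ) ^ m * form u (phi (-m) v) := by
  have hg : ∀ n : ℕ, 0 < n → genNorm n = 1 := fun n hn => if_neg (by omega)
  rcases lt_trichotomy m 0 with h | rfl | h
  · lift -m to ℕ using by omega with n hn
    obtain rfl : m = -(n : ℤ) := by omega
    have hn : 0 < n := by omega
    rw [phi_neg_natCast hn, phi_natCast hn, ← form_annih, hg n hn]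
    simp [← inv_pow, inv_neg]
  · have h0 : genNorm 0 = 1 / 2 := if_pos rfl
    have h1 := form_annih 0 u v
    have h2 := form_create 0 u v
    simp only [neg_zero, phi_zero, zpow_zero, one_mul, LinearMap.add_apply, map_add,
      LinearMap.smul_apply, map_smul, smul_eq_mul, ← h1, h2, h0]
    ring
  · lift m to ℕ using h.le
    have hm : 0 < m := by omega
    rw [phi_neg_natCast hm, phi_natCast hm, form_create, hg m hm, LinearMap.smul_apply, map_smul,
      smul_eq_mul, zpow_natCast, ← mul_assoc, ← mul_pow]
    simp

theorem annih_wedge_of_notMem {n : ℕ} {l : List ℕ} (h : n ∉ l) : annih n (wedge l) = 0 := by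
  induction l with
  | nil => exact annih_vac n
  | cons m l ih =>
    rw [List.mem_cons, not_or] at h
    rw [wedge_cons, annih_create_apply, if_neg h.1, ih h.2, map_zero, sub_zero]

/-- If the leading entries differ, the larger one is absent from the other list, and moving it
across as a contraction gives zero. Equal leading entries cancel against each other. -/
theorem form_wedge {l l' : List ℕ} (h : l.Pairwise (· > ·)) (h' : l'.Pairwise (· > ·)) :
    form (wedge l) (wedge l') = if l = l' then (l.map genNorm).prod else 0 := by
  induction l generalizing l' with
  | nil =>
    rcases l' with _ | ⟨n, l'⟩
    · simp [wedge_nil, form_vac, leftVac_vac]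
    · simp [wedge_nil, form_vac, wedge_cons, leftVac_create]
  | cons m l ih =>
    rw [List.pairwise_cons] at h
    have hm : m ∉ l := fun hm => lt_irrefl _ (h.1 m hm)
    rcases l' with _ | ⟨n, l'⟩
    · simp [wedge_nil, form_create, annih_vac, wedge_cons]
    · rw [List.pairwise_cons] at h'
      have hn : n ∉ l' := fun hn => lt_irrefl _ (h'.1 n hn)
      rcases lt_trichotomy m n with hmn | rfl | hmn
      · have : n ∉ m :: l := by
          rw [List.mem_cons, not_or]
          exact ⟨by omega, fun hx => by have := h.1 n hx; omega⟩
        rw [wedge_cons n, ← form_annih, annih_wedge_of_notMem this, map_zero,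
          LinearMap.zero_apply, mul_zero, if_neg (by simp; omega)]
      · rw [wedge_cons, form_create, wedge_cons, annih_create_apply, annih_wedge_of_notMem hn,
          if_pos rfl, map_zero, sub_zero, ih h.2 h'.2]
        by_cases e : l = l' <;> simp [e]
      · have : m ∉ n :: l' := by
          rw [List.mem_cons, not_or]
          exact ⟨by omega, fun hx => by have := h'.1 m hx; omega⟩
        rw [wedge_cons m, form_create, annih_wedge_of_notMem this, map_zero, mul_zero,
          if_neg (by simp; omega)]

theorem form_monomial (s t : Finset ℕ) :
    form (monomial s) (monomial t) = if s = t then ∏ n ∈ s, genNorm n else 0 := by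
  rw [monomial, monomial, form_wedge (sort_pairwise_gt s) (sort_pairwise_gt t)]
  by_cases h : s = t
  · subst h
    rw [if_pos rfl, if_pos rfl, ← List.prod_toFinset _ (Finset.sort_nodup _ _),
      Finset.sort_toFinset]
  · rw [if_neg h, if_neg]
    intro e
    apply h
    rw [← Finset.sort_toFinset (r := fun a b : ℕ => a ≥ b) (s := s), e, Finset.sort_toFinset]

/-- Monomials are orthogonal with nonzero norms, so pairing with them reads off the coefficients.
Vectors are shown to vanish by this test throughout. -/
theorem eq_zero_of_form_monomial {v : Fock} (h : ∀ s, form (monomial s) v = 0) : v = 0 := by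
  obtain ⟨c, rfl⟩ := exists_sum_monomial v
  have hc : c = 0 := by
    ext s
    have hs := h s
    rw [Finsupp.sum, map_sum, Finset.sum_eq_single s] at hs
    · rw [map_smul, form_monomial, if_pos rfl, smul_eq_mul] at hs
      exact (mul_eq_zero.1 hs).resolve_right
        (Finset.prod_ne_zero_iff.2 fun n _ => genNorm_ne_zero n)
    · intro t _ ht
      rw [map_smul, form_monomial, if_neg ht.symm, smul_zero]
    · intro hs
      rw [Finsupp.notMem_support_iff.1 hs, zero_smul, map_zero]
  rw [hc, Finsupp.sum_zero_index]

/-- A linear operator that is diagonal in the monomials is self-adjoint for the form. -/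
theorem form_monomial_diagonal {T : Module.End ℂ Fock} {c : Finset ℕ → ℂ}
    (hT : ∀ s, T (monomial s) = c s • monomial s) (s : Finset ℕ) (v : Fock) :
    form (monomial s) (T v) = c s * form (monomial s) v := by
  induction v using monomial_induction with
  | hzero => simp
  | hadd v w hv hw => simp only [map_add, hv, hw, mul_add]
  | hsmul a v hv => simp only [map_smul, hv, smul_eq_mul]; ring
  | hmon t =>
    rw [hT, map_smul, form_monomial, smul_eq_mul]
    by_cases h : s = t
    · rw [h]
    · simp [h]

/-! ### Bilinear operators in the fermions -/

theorem quadratic_apply (c : ℤ → ℂ) (s : ℤ) (hs : s ≠ 0) (v : Fock) :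
    quadratic c s hs v = ∑ᶠ n : ℤ, c n • phi n (phi (s - n) v) := rfl

theorem exists_quadratic_eq_sum (c : ℤ → ℂ) (s : ℤ) (hs : s ≠ 0) (v : Fock) :
    ∃ I : Finset ℤ, ∀ J, I ⊆ J → quadratic c s hs v = ∑ n ∈ J, c n • phi n (phi (s - n) v) := by
  refine ⟨(finite_support_quadratic c s hs v).toFinset, fun J hJ => ?_⟩
  rw [quadratic_apply]
  refine finsum_eq_sum_of_support_subset _ fun n hn => ?_
  exact hJ (by simpa using hn)

/-- Moving φ_m to the left through φ_n φ_{s-n} leaves a contraction with the right factor at n = s +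
m and one with the left factor at n = -m; both are multiples of φ_{s+m}. -/
theorem quadratic_phi (c : ℤ → ℂ) (s : ℤ) (hs : s ≠ 0) (m : ℤ) (v : Fock) :
    quadratic c s hs (phi m v) = phi m (quadratic c s hs v) +
      ((-1 : ℂ) ^ m * (c (s + m) - c (-m))) • phi (s + m) v := by
  obtain ⟨I, hI⟩ := exists_quadratic_eq_sum c s hs v
  obtain ⟨J, hJ⟩ := exists_quadratic_eq_sum c s hs (phi m v)
  -- A common finite index set for both sums, enlarged by the two indices where contractions occur.
  set K : Finset ℤ := I ∪ J ∪ {s + m, -m} with hK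
  rw [hI K fun n hn => by simp [hK, hn], hJ K fun n hn => by simp [hK, hn], map_sum]
  have h1 : ∀ n, c n • phi n (phi (s - n) (phi m v)) = phi m (c n • phi n (phi (s - n) v)) +
      ((if n = s + m then ((-1 : ℂ) ^ m * c (s + m)) • phi (s + m) v else 0) -
      (if n = -m then ((-1 : ℂ) ^ m * c (-m)) • phi (s + m) v else 0)) := by
    intro n
    rw [phi_phi (s - n) m, map_sub, map_smul, phi_phi n m]
    have e1 : ((-1 : ℂ) ^ (-m)) = (-1) ^ m := by rw [zpow_neg, ← inv_zpow, inv_neg, inv_one]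
    by_cases h1 : n = s + m
    · have h3 : s - n = -m := by omega
      by_cases h2 : n = -m
      · rw [if_pos h1, if_pos h2, if_pos h2, if_pos h3, h3, h2, show s + m = -m by omega, e1]
        simp only [map_smul]
        module
      · rw [if_pos h1, if_neg h2, if_neg h2, if_pos h3, h3, e1, h1]
        simp only [map_smul]
        module
    · have h3 : s - n ≠ -m := by omega
      rw [if_neg h1, if_neg h3]
      by_cases h2 : n = -m
      · rw [if_pos h2, if_pos h2, h2, e1, sub_neg_eq_add]
        simp only [map_smul]
        module
      · rw [if_neg h2, if_neg h2, map_smul]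
        module
  rw [Finset.sum_congr rfl fun n _ => h1 n, Finset.sum_add_distrib, Finset.sum_sub_distrib,
    Finset.sum_ite_eq', Finset.sum_ite_eq', if_pos (by simp [hK]), if_pos (by simp [hK])]
  congr 1
  module

theorem map_quadratic {M : Type*} [AddCommGroup M] [Module ℂ M] (T : Fock →ₗ[ℂ] M) (c : ℤ → ℂ) (s : ℤ)
    (hs : s ≠ 0) (v : Fock) :
    T (quadratic c s hs v) = ∑ᶠ n : ℤ, c n • T (phi n (phi (s - n) v)) := by
  rw [quadratic_apply, map_finsum T (finite_support_quadratic c s hs v)]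
  simp only [map_smul]

/-- For s < 0 one of n and s - n is negative, and the two factors anticommute because s ≠ 0. -/
theorem quadratic_vac (c : ℤ → ℂ) (s : ℤ) (hs : s < 0) : quadratic c s hs.ne vac = 0 := by
  rw [quadratic_apply, finsum_eq_zero_of_forall_eq_zero]
  intro n
  by_cases h : s - n < 0
  · rw [phi_vac _ h, map_zero, smul_zero]
  · rw [phi_phi_of_ne (by omega), phi_vac n (by omega), map_zero, neg_zero, smul_zero]

theorem leftVac_quadratic (c : ℤ → ℂ) (s : ℤ) (hs : 0 < s) (v : Fock) :
    leftVac (quadratic c s hs.ne' v) = 0 := by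
  rw [map_quadratic, finsum_eq_zero_of_forall_eq_zero]
  intro n
  by_cases h : 0 < n
  · rw [leftVac_phi _ h, smul_zero]
  · rw [phi_phi_of_ne (by omega), map_neg, leftVac_phi _ (by omega), neg_zero, smul_zero]

theorem parity_quadratic (c : ℤ → ℂ) (s : ℤ) (hs : s ≠ 0) (v : Fock) :
    parity (quadratic c s hs v) = quadratic c s hs (parity v) := by
  rw [map_quadratic, quadratic_apply]
  simp only [parity_phi, map_neg, neg_neg]

/-- The operator `-B_k` for `r = 1` and `k = 2 i + 1`. -/
def raise (i : ℕ) : Module.End ℂ Fock :=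
  quadratic (fun n => 1 / 2 * (-1 : ℂ) ^ (n + 1)) (2 * (i : ℤ) + 1) (by omega)

theorem neg_one_zpow_odd {n : ℤ} (h : Odd n) : (-1 : ℂ) ^ n = -1 := h.neg_one_zpow

theorem neg_one_zpow_congr {m n : ℤ} (h : Even (m + n)) : (-1 : ℂ) ^ m = (-1) ^ n := by
  rcases Int.even_or_odd m with hm | hm
  · rw [hm.neg_one_zpow, ((Int.even_add.1 h).1 hm).neg_one_zpow]
  · have hn : Odd n := by
      rw [← Int.not_even_iff_odd] at hm ⊢
      exact fun hn => hm ((Int.even_add.1 h).2 hn)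
    rw [hm.neg_one_zpow, hn.neg_one_zpow]

theorem neg_one_zpow_eq_neg {m n : ℤ} (h : Odd (m + n)) : (-1 : ℂ) ^ m = -(-1) ^ n := by
  rw [neg_one_zpow_congr (m := m) (n := n + 1) (by rw [← add_assoc]; exact h.add_one),
    zpow_add_one₀ (by norm_num), mul_neg_one]

theorem neg_one_zpow_mul_self (m : ℤ) : (-1 : ℂ) ^ m * (-1) ^ m = 1 := by
  rw [← zpow_add₀ (by norm_num), (Even.add_self m).neg_one_zpow]

/-- The two contractions contribute ½ each with equal signs, so the bracket with H_k is a pure shift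
of the index. -/
theorem opH_phi (i : ℕ) (m : ℤ) (v : Fock) :
    opH i (phi m v) = phi m (opH i v) + phi (m - (2 * i + 1)) v := by
  rw [opH, quadratic_phi, neg_add_eq_sub]
  congr 1
  rw [neg_one_zpow_congr (m := m - (2 * i + 1) + 1) (n := m) ⟨m - i, by ring⟩,
    neg_one_zpow_eq_neg (m := -m + 1) (n := m) ⟨0, by ring⟩]
  have := neg_one_zpow_mul_self m
  rw [show (-1 : ℂ) ^ m * (1 / 2 * (-1) ^ m - 1 / 2 * -(-1) ^ m) = (-1) ^ m * (-1) ^ m by ring, this,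
    one_smul]

theorem raise_phi (i : ℕ) (m : ℤ) (v : Fock) :
    raise i (phi m v) = phi m (raise i v) + phi (m + (2 * i + 1)) v := by
  rw [raise, quadratic_phi, add_comm _ m]
  congr 1
  rw [neg_one_zpow_congr (m := m + (2 * i + 1) + 1) (n := m) ⟨m + i + 1, by ring⟩,
    neg_one_zpow_eq_neg (m := -m + 1) (n := m) ⟨0, by ring⟩]
  have := neg_one_zpow_mul_self m
  rw [show (-1 : ℂ) ^ m * (1 / 2 * (-1) ^ m - 1 / 2 * -(-1) ^ m) = (-1) ^ m * (-1) ^ m by ring, this,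
    one_smul]

/-- The reflection x ↦ 1 - x carries the window 1-n, …, k-n of arguments onto n-k+1, …, n. The
symmetry of r enters the proof only through this identity. -/
theorem prod_reflect {r : ℤ → ℂ} (hr : ∀ n : ℤ, r n = r (1 - n)) (k : ℕ) (n : ℤ) :
    ∏ j ∈ Finset.range k, r (k - n - j) = ∏ j ∈ Finset.range k, r (n - j) := by
  rw [← Finset.prod_range_reflect]
  refine Finset.prod_congr rfl fun j hj => ?_
  have hj := Finset.mem_range.1 hj
  rw [hr]
  congr 1
  omega

/-- By the reflection the two contractions carry the same product of values of r, and the bracket is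
a weighted shift. -/
theorem opB_phi {r : ℤ → ℂ} (hr : ∀ n : ℤ, r n = r (1 - n)) (i : ℕ) (m : ℤ) (v : Fock) :
    opB r i (phi m v) = phi m (opB r i v) -
      (∏ j ∈ Finset.range (2 * i + 1), r (m + (2 * i + 1) - j)) • phi (m + (2 * i + 1)) v := by
  rw [opB, quadratic_phi, add_comm _ m, sub_eq_add_neg (phi m _), ← neg_smul]
  congr 2
  have h := prod_reflect hr (2 * i + 1) (-m)
  rw [show (((2 * i + 1 : ℕ) : ℤ) - -m) = m + (2 * i + 1) by push_cast; ring] at h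
  rw [← h, neg_one_zpow_eq_neg (m := m + (2 * i + 1)) (n := m) ⟨m + i, by ring⟩,
    neg_one_zpow_congr (m := -m) (n := m) ⟨0, by ring⟩]
  linear_combination (-(∏ j ∈ Finset.range (2 * i + 1), r (m + (2 * i + 1) - j))) *
    neg_one_zpow_mul_self m

theorem opB_one (i : ℕ) : opB (fun _ => 1) i = -raise i := by
  refine LinearMap.ext fun v => ?_
  rw [LinearMap.neg_apply, opB, raise, quadratic_apply, quadratic_apply, ← finsum_neg_distrib]
  refine finsum_congr fun n => ?_
  rw [← neg_smul, neg_one_zpow_eq_neg (m := n + 1) (n := n) ⟨n, by ring⟩]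
  simp

theorem opH_vac (i : ℕ) : opH i vac = 0 := quadratic_vac _ _ (by omega)

theorem leftVac_opB (r : ℤ → ℂ) (i : ℕ) (v : Fock) : leftVac (opB r i v) = 0 :=
  leftVac_quadratic _ _ (by omega) v

theorem leftVac_raise (i : ℕ) (v : Fock) : leftVac (raise i v) = 0 :=
  leftVac_quadratic _ _ (by omega) v

theorem parity_opH (i : ℕ) (v : Fock) : parity (opH i v) = opH i (parity v) :=
  parity_quadratic _ _ _ v

theorem parity_raise (i : ℕ) (v : Fock) : parity (raise i v) = raise i (parity v) :=
  parity_quadratic _ _ _ v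

/-- The lowering operator `H_k` is adjoint to the raising operator `-B_k`, `r = 1`. -/
theorem form_raise (i : ℕ) (u v : Fock) : form (raise i u) v = form u (opH i v) := by
  have h1 : form (raise i u) v = (form.flip v) (raise i u) := rfl
  -- Taking adjoints turns φ_n φ_{k-n} into a multiple of φ_{n-k} φ_{-n}; the shift n ↦ n + k makes
  -- this the n-th term of H_k.
  rw [h1, raise, map_quadratic, opH, map_quadratic,
    ← finsum_comp_equiv (Equiv.addRight (2 * (i : ℤ) + 1))]
  refine finsum_congr fun n => ?_
  simp only [LinearMap.flip_apply, form_phi, Equiv.coe_addRight, smul_eq_mul]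
  have e1 : -(2 * (i : ℤ) + 1 - (n + (2 * i + 1))) = n := by ring
  have e2 : -(n + (2 * (i : ℤ) + 1)) = -(2 * (i : ℤ) + 1) - n := by ring
  rw [e1, e2, ← mul_assoc, ← mul_assoc]
  congr 1
  rw [show (2 * (i : ℤ) + 1 - (n + (2 * i + 1))) = -n by ring,
    neg_one_zpow_congr (m := n + (2 * i + 1) + 1) (n := n) ⟨n + i + 1, by ring⟩,
    neg_one_zpow_eq_neg (m := n + (2 * i + 1)) (n := n) ⟨n + i, by ring⟩,
    neg_one_zpow_congr (m := -n) (n := n) ⟨0, by ring⟩,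
    neg_one_zpow_eq_neg (m := n + 1) (n := n) ⟨n, by ring⟩]
  linear_combination (-1 / 2 * (-1 : ℂ) ^ n) * neg_one_zpow_mul_self n

/-! ### Irreducibility and commutation relations -/

/-- In the pairing with a monomial the leading φ_n, n > 0, moves across as a multiple of φ_{-n},
which kills v. Only the monomials 1 and e_0 remain, and the last two hypotheses deal with them. -/
theorem eq_zero_of_phi_neg {v : Fock} (h : ∀ m < 0, phi m v = 0) (h0 : leftVac v = 0)
    (h1 : leftVac (phi 0 v) = 0) : v = 0 := by
  refine eq_zero_of_form_monomial fun s => ?_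
  rw [monomial]
  have hs := sort_pairwise_gt s
  generalize s.sort (fun a b => a ≥ b) = l at hs
  rcases l with _ | ⟨n, l⟩
  · rw [wedge_nil, form_vac, h0]
  · rw [wedge_cons_of_sorted hs, form_phi]
    rcases Nat.eq_zero_or_pos n with rfl | hn
    · have hl : l = [] := by
        rcases l with _ | ⟨x, l⟩
        · rfl
        · exact absurd ((List.pairwise_cons.1 hs).1 x (by simp)) (by omega)
      rw [hl, wedge_nil, form_vac, Nat.cast_zero, neg_zero, h1, mul_zero]
    · rw [h _ (by omega), map_zero, mul_zero]

theorem leftVac_phi_zero_of_parity {v : Fock} (h : parity v = v) : leftVac (phi 0 v) = 0 := by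
  have h1 := leftVac_parity (phi 0 v)
  rw [parity_phi, h, map_neg] at h1
  have h2 : (2 : ℂ) * leftVac (phi 0 v) = 0 := by linear_combination -h1
  simpa using h2

/-- The vacuum is cyclic for the fermions. Even operators are tested with ε = 1, odd ones with ε =
-1; the vanishing on the vacuum is then checked by `phi_vac_of_commute` and `eq_zero_of_phi_neg`. -/
theorem eq_zero_of_commute {A : Module.End ℂ Fock} {ε : ℂ}
    (h : ∀ (m : ℤ) v, A (phi m v) = ε • phi m (A v)) (hv : A vac = 0) : A = 0 := by
  refine LinearMap.ext fun v => ?_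
  rw [LinearMap.zero_apply]
  induction v using phi_induction with
  | hvac => exact hv
  | hadd v w hv hw => rw [map_add, hv, hw, add_zero]
  | hsmul a v hv => rw [map_smul, hv, smul_zero]
  | hphi n v hv => rw [h, hv, map_zero, smul_zero]

theorem phi_vac_of_commute {A : Module.End ℂ Fock} {ε : ℂ} (hε : ε ≠ 0)
    (h : ∀ (m : ℤ) v, A (phi m v) = ε • phi m (A v)) {m : ℤ} (hm : m < 0) : phi m (A vac) = 0 := by
  have h1 := h m vac
  rw [phi_vac m hm, map_zero] at h1
  exact (smul_eq_zero.1 h1.symm).resolve_left hε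

theorem commute_opH (i j : ℕ) : Commute (opH i) (opH j) := by
  refine sub_eq_zero.1 (eq_zero_of_commute (ε := 1) (fun m v => ?_) ?_)
  · simp only [LinearMap.sub_apply, Module.End.mul_apply, opH_phi, map_add, map_sub]
    rw [show m - (2 * (j : ℤ) + 1) - (2 * i + 1) = m - (2 * (i : ℤ) + 1) - (2 * j + 1) by ring]
    module
  · simp [opH_vac]

theorem commute_opB {r : ℤ → ℂ} (hr : ∀ n : ℤ, r n = r (1 - n)) (i j : ℕ) :
    Commute (opB r i) (opB r j) := by
  have key : ∀ (m : ℤ) v, (opB r i * opB r j - opB r j * opB r i) (phi m v) =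
      (1 : ℂ) • phi m ((opB r i * opB r j - opB r j * opB r i) v) := by
    intro m v
    -- The windows of two successive weighted shifts join to a single window of length k + l,
    -- independent of the order of the shifts.
    have hp : ∀ i j : ℕ, (∏ t ∈ Finset.range (2 * j + 1), r (m + (2 * j + 1) - t)) *
        ∏ t ∈ Finset.range (2 * i + 1), r (m + (2 * j + 1) + (2 * i + 1) - t) =
        ∏ t ∈ Finset.range ((2 * i + 1) + (2 * j + 1)), r (m + (2 * j + 1) + (2 * i + 1) - t) := by
      intro i j
      rw [Finset.prod_range_add _ (2 * i + 1) (2 * j + 1), mul_comm]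
      refine congrArg₂ (· * ·) rfl (Finset.prod_congr rfl fun t _ => congrArg r ?_)
      push_cast
      ring
    have h1 := hp i j
    have h2 := hp j i
    rw [add_comm (2 * j + 1), show m + (2 * (i : ℤ) + 1) + (2 * j + 1) =
      m + (2 * (j : ℤ) + 1) + (2 * i + 1) by ring] at h2
    have h3 := h1.trans h2.symm
    simp only [LinearMap.sub_apply, Module.End.mul_apply, opB_phi hr, map_smul, map_sub]
    rw [show m + (2 * (i : ℤ) + 1) + (2 * j + 1) = m + (2 * (j : ℤ) + 1) + (2 * i + 1) by ring]
    linear_combination (norm := module) h3 • (phi (m + (2 * (j : ℤ) + 1) + (2 * i + 1)) v)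
  refine sub_eq_zero.1 (eq_zero_of_commute key ?_)
  refine eq_zero_of_phi_neg (fun m hm => phi_vac_of_commute one_ne_zero key hm) ?_ ?_
  · simp [leftVac_opB]
  -- The commutator moves past φ_0 to the left end, where ⟨0| kills it.
  · have h := key 0 vac
    rw [one_smul] at h
    rw [← h]
    simp [leftVac_opB]

theorem commute_raise (i j : ℕ) : Commute (raise i) (raise j) := by
  have h := commute_opB (r := fun _ => 1) (fun _ => rfl) i j
  rw [opB_one, opB_one] at h
  exact Commute.neg_left_iff.1 (Commute.neg_right_iff.1 h)

/-- The vacuum expectation value `⟨0| φ_{-b} φ_b |0⟩`. -/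
def propagator (b : ℤ) : ℂ := if 0 < b then (-1) ^ b else if b = 0 then 1 / 2 else 0

theorem leftVac_phi_phi (a b : ℤ) :
    leftVac (phi a (phi b vac)) = if a + b = 0 then propagator b else 0 := by
  rcases lt_trichotomy b 0 with hb | rfl | hb
  · rw [phi_vac b hb, map_zero, map_zero, propagator, if_neg (not_lt.2 hb.le), if_neg hb.ne,
      ite_self]
  · rcases lt_trichotomy a 0 with ha | rfl | ha
    · rw [phi_phi_of_ne (by omega), phi_vac a ha, map_zero, neg_zero, map_zero, if_neg (by omega)]
    · have h := phi_phi 0 0 vac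
      rw [if_pos (by simp), zpow_zero, one_smul, eq_sub_iff_add_eq, ← two_smul ℂ] at h
      have h1 := congrArg leftVac h
      rw [map_smul, leftVac_vac, smul_eq_mul] at h1
      rw [if_pos (by simp), propagator, if_neg (lt_irrefl _), if_pos rfl]
      linear_combination 1 / 2 * h1
    · rw [leftVac_phi a ha, if_neg (by omega)]
  · rw [phi_phi, map_sub, leftVac_phi b hb, sub_zero, map_smul, leftVac_vac, smul_eq_mul, mul_one]
    by_cases h : a + b = 0
    · rw [if_pos (by omega), if_pos h, propagator, if_pos hb]
      exact neg_one_zpow_congr (by rw [h]; exact Even.zero)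
    · rw [if_neg (by omega), if_neg h]

/-- For i = j only 0 ≤ n ≤ k contribute: the interior indices give ½ each, and the ends 0 and k give
¼ each because ⟨0|φ_0 φ_0|0⟩ = ½. The total is k/2. -/
theorem leftVac_opH_raise (i j : ℕ) :
    leftVac (opH i (raise j vac)) = if i = j then (2 * (i : ℂ) + 1) / 2 else 0 := by
  have h1 : leftVac (opH i (raise j vac)) = (leftVac ∘ₗ opH i) (raise j vac) := rfl
  rw [h1, raise, map_quadratic]
  simp only [LinearMap.comp_apply, opH_phi, opH_vac, map_zero, map_add, leftVac_phi_phi, zero_add]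
  by_cases h : i = j
  · subst h
    rw [if_pos rfl]
    have hg : ∀ n : ℤ, ((1 / 2 * (-1 : ℂ) ^ (n + 1)) •
        ((if n + (2 * (i : ℤ) + 1 - n - (2 * i + 1)) = 0 then
          propagator (2 * (i : ℤ) + 1 - n - (2 * i + 1)) else 0) +
        if n - (2 * (i : ℤ) + 1) + (2 * i + 1 - n) = 0 then propagator (2 * (i : ℤ) + 1 - n) else 0)) =
        if 0 ≤ n ∧ n ≤ 2 * (i : ℤ) + 1 then
          1 / 4 * ((if n < 2 * (i : ℤ) + 1 then 1 else 0) + if 0 < n then 1 else 0) else 0 := by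
      intro n
      rw [if_pos (by ring), if_pos (by ring), smul_eq_mul,
        show 2 * (i : ℤ) + 1 - n - (2 * i + 1) = -n by ring, propagator, propagator,
        neg_one_zpow_eq_neg (m := 2 * i + 1 - n) (n := n) ⟨i, by ring⟩,
        neg_one_zpow_congr (m := -n) (n := n) ⟨0, by ring⟩,
        neg_one_zpow_eq_neg (m := n + 1) (n := n) ⟨n, by ring⟩]
      have hs := neg_one_zpow_mul_self n
      rcases lt_trichotomy n 0 with hn | rfl | hn
      · rw [if_pos (by omega), if_pos (by omega), if_neg (by omega)]
        ring
      · rw [if_neg (by omega), if_pos (by omega), if_pos (by omega), if_pos (by omega),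
          if_pos (by omega), if_neg (by omega), zpow_zero]
        norm_num
      · rcases lt_trichotomy n (2 * i + 1) with hk | rfl | hk
        · rw [if_neg (by omega), if_neg (by omega), if_pos (by omega), if_pos (by omega),
            if_pos (by omega), if_pos (by omega)]
          linear_combination 1 / 2 * hs
        · rw [if_neg (by omega), if_neg (by omega), if_neg (by omega), if_pos (by omega),
            if_pos (by omega), if_neg (by omega), if_pos (by omega),
            neg_one_zpow_odd ⟨(i : ℤ), by ring⟩]
          norm_num
        · rw [if_neg (by omega), if_neg (by omega), if_neg (by omega), if_neg (by omega),
            if_neg (by omega)]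
          ring
    rw [finsum_congr hg, finsum_eq_sum_of_support_subset (s := Finset.Icc (0 : ℤ) (2 * i + 1)) _
      (fun n hn => by
        by_contra hc
        exact hn (if_neg (by simpa only [Finset.coe_Icc, Set.mem_Icc] using hc))),
      Finset.sum_congr rfl fun n hn => if_pos (Finset.mem_Icc.1 hn), ← Finset.mul_sum, Finset.sum_add_distrib,
      Finset.sum_boole, Finset.sum_boole]
    have e1 : (Finset.Icc (0 : ℤ) (2 * i + 1)).filter (fun n => n < 2 * (i : ℤ) + 1) =
        Finset.Ico (0 : ℤ) (2 * i + 1) := by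
      ext n; simp only [Finset.mem_filter, Finset.mem_Icc, Finset.mem_Ico]; omega
    have e2 : (Finset.Icc (0 : ℤ) (2 * i + 1)).filter (fun n => 0 < n) =
        Finset.Ioc (0 : ℤ) (2 * i + 1) := by
      ext n; simp only [Finset.mem_filter, Finset.mem_Icc, Finset.mem_Ioc]; omega
    have e3 : (2 * (i : ℤ) + 1 - 0).toNat = 2 * i + 1 := by omega
    rw [e1, e2, Int.card_Ico, Int.card_Ioc, e3]
    push_cast
    ring
  · rw [if_neg h, finsum_eq_zero_of_forall_eq_zero]
    intro n
    rw [if_neg (by omega), if_neg (by omega), add_zero, smul_zero]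

/-- The Heisenberg relation `[H_k, -B_l] = (k/2) δ_{k,l}` for `r = 1`. -/
theorem opH_raise (i j : ℕ) (v : Fock) :
    opH i (raise j v) = raise j (opH i v) + (if i = j then (2 * (i : ℂ) + 1) / 2 else 0) • v := by
  set κ : ℂ := if i = j then (2 * (i : ℂ) + 1) / 2 else 0 with hκ
  -- The brackets with the two operators shift indices by -k and +l. These shifts commute, so the
  -- commutator commutes with all fermions and is a scalar.
  have key : ∀ (m : ℤ) v, (opH i * raise j - raise j * opH i - κ • 1) (phi m v) =
      (1 : ℂ) • phi m ((opH i * raise j - raise j * opH i - κ • 1) v) := by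
    intro m v
    simp only [LinearMap.sub_apply, Module.End.mul_apply, opH_phi, raise_phi, map_add, map_sub,
      LinearMap.smul_apply, Module.End.one_apply, map_smul]
    rw [show m + (2 * (j : ℤ) + 1) - (2 * i + 1) = m - (2 * (i : ℤ) + 1) + (2 * j + 1) by ring]
    module
  have h0 : opH i * raise j - raise j * opH i - κ • 1 = 0 := by
    refine eq_zero_of_commute key ?_
    refine eq_zero_of_phi_neg (fun m hm => phi_vac_of_commute one_ne_zero key hm) ?_ ?_
    · simp only [LinearMap.sub_apply, Module.End.mul_apply, LinearMap.smul_apply,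
        Module.End.one_apply, opH_vac, map_zero, map_sub, map_smul, leftVac_vac,
        leftVac_opH_raise, smul_eq_mul, sub_zero, mul_one, hκ, sub_self]
    · refine leftVac_phi_zero_of_parity ?_
      simp only [LinearMap.sub_apply, Module.End.mul_apply, LinearMap.smul_apply,
        Module.End.one_apply, map_sub, map_smul, parity_opH, parity_raise, parity_vac]
  have h1 := congrArg (fun T : Module.End ℂ Fock => T v) h0
  simp only [LinearMap.sub_apply, Module.End.mul_apply, LinearMap.smul_apply,
    Module.End.one_apply, LinearMap.zero_apply] at h1
  linear_combination (norm := module) h1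

/-! ### The Sugawara operator -/

open Filter in
theorem eventually_phi_sub_eq_zero (n : ℤ) (v : Fock) :
    ∀ᶠ i : ℕ in atTop, phi (n - (2 * i + 1)) v = 0 := by
  obtain ⟨N, hN⟩ := exists_phi_eq_zero v
  filter_upwards [eventually_ge_atTop (N + n.natAbs)] with i hi
  exact hN _ (by omega)

open Filter in
theorem eventually_opH_eq_zero (v : Fock) : ∀ᶠ i in atTop, opH i v = 0 := by
  induction v using phi_induction with
  | hvac => exact Eventually.of_forall opH_vac
  | hadd v w hv hw =>
    filter_upwards [hv, hw] with i h1 h2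
    rw [map_add, h1, h2, add_zero]
  | hsmul a v hv =>
    filter_upwards [hv] with i h1
    rw [map_smul, h1, smul_zero]
  | hphi n v hv =>
    filter_upwards [hv, eventually_phi_sub_eq_zero n v] with i h1 h2
    rw [opH_phi, h1, h2, map_zero, add_zero]

theorem finite_support_raise_opH (v : Fock) :
    (Function.support fun i : ℕ => raise i (opH i v)).Finite := by
  obtain ⟨N, hN⟩ := Filter.eventually_atTop.1 (eventually_opH_eq_zero v)
  refine (Set.finite_Iio N).subset fun i hi => ?_
  by_contra h
  exact hi (by simp only [hN i (not_lt.1 h), map_zero])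

/-- The Sugawara operator `-∑_k B_k H_k` for `r = 1` (on each vector a finite sum). -/
def sugawara : Module.End ℂ Fock where
  toFun v := ∑ᶠ i : ℕ, raise i (opH i v)
  map_add' v w := by
    simp only [map_add]
    exact finsum_add_distrib (finite_support_raise_opH v) (finite_support_raise_opH w)
  map_smul' a v := by
    simp only [map_smul, RingHom.id_apply]
    rw [smul_finsum' a (finite_support_raise_opH v)]

/-- The partial sums of the Sugawara operator. -/
def sugawaraSum (N : ℕ) : Module.End ℂ Fock := ∑ i ∈ Finset.range N, raise i * opH i

open Filter in
theorem eventually_sugawara_eq (v : Fock) : ∀ᶠ N in atTop, sugawara v = sugawaraSum N v := by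
  obtain ⟨N, hN⟩ := eventually_atTop.1 (eventually_opH_eq_zero v)
  filter_upwards [eventually_ge_atTop N] with M hM
  simp only [sugawaraSum, LinearMap.sum_apply, Module.End.mul_apply]
  refine finsum_eq_sum_of_support_subset _ fun i hi => ?_
  rw [Finset.coe_range, Set.mem_Iio]
  by_contra h
  exact hi (by simp only [hN i (by omega), map_zero])

theorem sugawara_vac : sugawara vac = 0 := by
  obtain ⟨N, hN⟩ := (eventually_sugawara_eq vac).exists
  rw [hN]
  simp [sugawaraSum, opH_vac]

theorem leftVac_sugawara (v : Fock) : leftVac (sugawara v) = 0 := by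
  obtain ⟨N, hN⟩ := (eventually_sugawara_eq v).exists
  rw [hN]
  simp [sugawaraSum, leftVac_raise]

theorem parity_sugawara (v : Fock) : parity (sugawara v) = sugawara (parity v) := by
  obtain ⟨N, h1, h2⟩ := ((eventually_sugawara_eq v).and (eventually_sugawara_eq (parity v))).exists
  rw [h1, h2]
  simp [sugawaraSum, parity_raise, parity_opH]

/-- The commutator with `φ_m`. -/
def commPhi (m : ℤ) : Module.End ℂ Fock →ₗ[ℂ] Module.End ℂ Fock :=
  LinearMap.mulRight ℂ (phi m) - LinearMap.mulLeft ℂ (phi m)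

/-- The anticommutator with `φ_m`. -/
def anticommPhi (m : ℤ) : Module.End ℂ Fock →ₗ[ℂ] Module.End ℂ Fock :=
  LinearMap.mulRight ℂ (phi m) + LinearMap.mulLeft ℂ (phi m)

theorem commPhi_apply (m : ℤ) (S : Module.End ℂ Fock) (v : Fock) :
    commPhi m S v = S (phi m v) - phi m (S v) := rfl

theorem anticommPhi_apply (m : ℤ) (S : Module.End ℂ Fock) (v : Fock) :
    anticommPhi m S v = S (phi m v) + phi m (S v) := rfl

theorem commPhi_raise_opH (i : ℕ) (m : ℤ) (v : Fock) :
    commPhi m (raise i * opH i) v =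
      raise i (phi (m - (2 * i + 1)) v) + phi (m + (2 * i + 1)) (opH i v) := by
  simp only [commPhi_apply, Module.End.mul_apply, opH_phi, map_add, raise_phi]
  abel

theorem anticommPhi_commPhi_raise_opH (i : ℕ) (m l : ℤ) (v : Fock) :
    anticommPhi l (commPhi m (raise i * opH i)) v =
      phi (m + (2 * i + 1)) (phi (l - (2 * i + 1)) v) -
        phi (l + (2 * i + 1)) (phi (m - (2 * i + 1)) v) +
      (if m + (2 * i + 1) = -l then (-1 : ℂ) ^ (m + (2 * i + 1)) else 0) • opH i v +
      (if m - (2 * i + 1) = -l then (-1 : ℂ) ^ (m - (2 * i + 1)) else 0) • raise i v := by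
  have h1 := phi_phi (m + (2 * i + 1)) l (opH i v)
  have h2 := congrArg (raise i) (phi_phi (m - (2 * i + 1)) l v)
  rw [map_sub, map_smul] at h2
  have h3 := raise_phi i l (phi (m - (2 * i + 1)) v)
  simp only [anticommPhi_apply, commPhi_raise_opH, opH_phi, map_add]
  linear_combination (norm := module) h1 + h2 - h3

/-- The Kronecker symbol of `2 i + 1` and `a`. -/
def oddDelta (i : ℕ) (a : ℤ) : ℂ := if 2 * (i : ℤ) + 1 = a then 1 else 0

theorem ite_smul_phi_eq {i : ℕ} {a b c d e j : ℤ}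
    (h : b = c ↔ 2 * (i : ℤ) + 1 = a) (h' : 2 * (i : ℤ) + 1 = a → Even (b + j) ∧ d = e) (v : Fock) :
    (if b = c then (-1 : ℂ) ^ b else 0) • phi d v = ((-1 : ℂ) ^ j * oddDelta i a) • phi e v := by
  unfold oddDelta
  by_cases hc : b = c
  · obtain ⟨h1, h2⟩ := h' (h.1 hc)
    rw [if_pos hc, if_pos (h.1 hc), neg_one_zpow_congr h1, h2, mul_one]
  · rw [if_neg hc, if_neg (fun h1 => hc (h.2 h1)), mul_zero, zero_smul, zero_smul]

/-- A summand A_k H_k is quartic in the fermions, so three successive brackets leave a multiple of a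
single fermion. Its six contributions are the contractions `t1`–`t6`. -/
theorem triple_comm_raise_opH (i : ℕ) (m l j : ℤ) (v : Fock) :
    commPhi j (anticommPhi l (commPhi m (raise i * opH i))) v =
      ((-1 : ℂ) ^ j * ((oddDelta i (l + j) + oddDelta i (-(l + j))) -
        (oddDelta i (m + j) + oddDelta i (-(m + j)))) +
        (-1 : ℂ) ^ l * (oddDelta i (m + l) + oddDelta i (-(m + l)))) • phi (m + l + j) v := by
  have h1 := congrArg (phi (m + (2 * i + 1))) (phi_phi (l - (2 * i + 1)) j v)
  have h2 := phi_phi (m + (2 * i + 1)) j (phi (l - (2 * i + 1)) v)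
  have h3 := congrArg (phi (l + (2 * i + 1))) (phi_phi (m - (2 * i + 1)) j v)
  have h4 := phi_phi (l + (2 * i + 1)) j (phi (m - (2 * i + 1)) v)
  rw [map_sub, map_smul] at h1 h3
  have t1 := ite_smul_phi_eq (i := i) (a := l + j) (b := l - (2 * i + 1)) (c := -j)
    (d := m + (2 * i + 1)) (e := m + l + j) (j := j) (by omega)
    (fun h => ⟨⟨0, by omega⟩, by omega⟩) v
  have t2 := ite_smul_phi_eq (i := i) (a := -(m + j)) (b := m + (2 * i + 1)) (c := -j)
    (d := l - (2 * i + 1)) (e := m + l + j) (j := j) (by omega)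
    (fun h => ⟨⟨0, by omega⟩, by omega⟩) v
  have t3 := ite_smul_phi_eq (i := i) (a := m + j) (b := m - (2 * i + 1)) (c := -j)
    (d := l + (2 * i + 1)) (e := m + l + j) (j := j) (by omega)
    (fun h => ⟨⟨0, by omega⟩, by omega⟩) v
  have t4 := ite_smul_phi_eq (i := i) (a := -(l + j)) (b := l + (2 * i + 1)) (c := -j)
    (d := m - (2 * i + 1)) (e := m + l + j) (j := j) (by omega)
    (fun h => ⟨⟨0, by omega⟩, by omega⟩) v
  have t5 := ite_smul_phi_eq (i := i) (a := -(m + l)) (b := m + (2 * i + 1)) (c := -l)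
    (d := j - (2 * i + 1)) (e := m + l + j) (j := l) (by omega)
    (fun h => ⟨⟨0, by omega⟩, by omega⟩) v
  have t6 := ite_smul_phi_eq (i := i) (a := m + l) (b := m - (2 * i + 1)) (c := -l)
    (d := j + (2 * i + 1)) (e := m + l + j) (j := l) (by omega)
    (fun h => ⟨⟨0, by omega⟩, by omega⟩) v
  rw [commPhi_apply]
  simp only [anticommPhi_commPhi_raise_opH, opH_phi, raise_phi, map_add, map_sub, map_smul]
  linear_combination (norm := module) h1 - h2 - h3 + h4 + t1 - t2 - t3 + t4 + t5 + t6

theorem sum_oddDelta {N : ℕ} {a : ℤ} (h : a.natAbs ≤ N) :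
    ∑ i ∈ Finset.range N, (oddDelta i a + oddDelta i (-a)) = if Odd a then 1 else 0 := by
  split
  · rename_i ha
    obtain ⟨b, hb⟩ := ha
    rw [Finset.sum_eq_single ((a.natAbs - 1) / 2)]
    · unfold oddDelta
      rcases le_total 0 a with h0 | h0
      · rw [if_pos (by omega), if_neg (by omega), add_zero]
      · rw [if_neg (by omega), if_pos (by omega), zero_add]
    · intro i _ hi
      unfold oddDelta
      rw [if_neg (by omega), if_neg (by omega), add_zero]
    · intro hi
      exact absurd (Finset.mem_range.2 (by omega)) hi
  · rename_i ha
    refine Finset.sum_eq_zero fun i _ => ?_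
    unfold oddDelta
    rw [if_neg (fun h => ha ⟨i, h.symm⟩), if_neg (fun h => ha ⟨-i - 1, by omega⟩), add_zero]

/-- Summed over all odd k, the Kronecker symbols become parity indicators of l + j, m + j and m + l,
and their signed combination cancels. The Sugawara operator thus has no genuinely quartic part. -/
theorem triple_comm_sugawara (m l j : ℤ) :
    commPhi j (anticommPhi l (commPhi m sugawara)) = 0 := by
  refine LinearMap.ext fun v => ?_
  have hs := eventually_sugawara_eq
  -- One cutoff serves all eight vectors in the triple bracket and is large enough for
  -- `sum_oddDelta`.
  obtain ⟨N, ⟨hN, h1, h2, h3, h4⟩, h5, h6, h7, h8⟩ :=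
    (((Filter.eventually_ge_atTop (m.natAbs + l.natAbs + j.natAbs)).and ((hs v).and ((hs (phi m v)).and
      ((hs (phi l v)).and (hs (phi j v)))))).and ((hs (phi m (phi l v))).and
      ((hs (phi m (phi j v))).and ((hs (phi l (phi j v))).and
      (hs (phi m (phi l (phi j v)))))))).exists
  have e : commPhi j (anticommPhi l (commPhi m sugawara)) v =
      commPhi j (anticommPhi l (commPhi m (sugawaraSum N))) v := by
    simp only [commPhi_apply, anticommPhi_apply, h1, h2, h3, h4, h5, h6, h7, h8]
  rw [e, sugawaraSum, map_sum, map_sum, map_sum, LinearMap.sum_apply]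
  simp only [triple_comm_raise_opH]
  rw [← Finset.sum_smul, Finset.sum_add_distrib, ← Finset.mul_sum, ← Finset.mul_sum,
    Finset.sum_sub_distrib, sum_oddDelta (by omega), sum_oddDelta (by omega),
    sum_oddDelta (by omega), LinearMap.zero_apply]
  have hc : (-1 : ℂ) ^ j * ((if Odd (l + j) then 1 else 0) - if Odd (m + j) then 1 else 0) +
      (-1 : ℂ) ^ l * (if Odd (m + l) then 1 else 0) = 0 := by
    rcases Int.even_or_odd m with hm | hm <;> rcases Int.even_or_odd l with hl | hl <;>
      rcases Int.even_or_odd j with hj | hj <;>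
      simp [hm, hl, hj, Int.odd_add, Int.not_even_iff_odd.2, hj.neg_one_zpow, hl.neg_one_zpow,
        Int.not_odd_iff_even.2]
  rw [hc, zero_smul]

/-- The arguments run down from l - 1 in steps of 2. The value ½ at argument 0, reached only for odd
l, makes the formula uniform in the parity of l. -/
theorem sum_propagator {l N : ℕ} (h : l ≤ N) :
    ∑ i ∈ Finset.range N, propagator (l - (2 * i + 1)) = -((-1) ^ l * l / 2) := by
  induction l using Nat.twoStepInduction generalizing N with
  | zero =>
    refine (Finset.sum_eq_zero fun i _ => ?_).trans (by simp)
    rw [propagator, if_neg (by omega), if_neg (by omega)]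
  | one =>
    obtain ⟨N, rfl⟩ : ∃ M, N = M + 1 := ⟨N - 1, by omega⟩
    rw [Finset.sum_range_succ', Finset.sum_eq_zero fun i _ => ?_]
    · simp [propagator]
      norm_num
    · rw [propagator, if_neg (by push_cast; omega), if_neg (by push_cast; omega)]
  | more l ih _ =>
    obtain ⟨N, rfl⟩ : ∃ M, N = M + 1 := ⟨N - 1, by omega⟩
    rw [Finset.sum_range_succ']
    have e : ∀ i : ℕ, ((l + 2 : ℕ) : ℤ) - (2 * ((i + 1 : ℕ) : ℤ) + 1) = l - (2 * i + 1) := by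
      intro i; push_cast; ring
    simp only [e]
    rw [ih (by omega), propagator, if_pos (by push_cast; omega),
      show ((l + 2 : ℕ) : ℤ) - (2 * ((0 : ℕ) : ℤ) + 1) = ((l + 1 : ℕ) : ℤ) by push_cast; ring,
      zpow_natCast]
    push_cast
    ring

theorem leftVac_phi_sugawara_phi (m l : ℤ) : leftVac (phi m (sugawara (phi l vac))) =
    if m + l = 0 then (if 0 ≤ l then (-1 : ℂ) ^ l * l / 2 else 0) else 0 := by
  rcases lt_or_ge l 0 with hl | hl
  · rw [phi_vac l hl, map_zero, map_zero, map_zero, if_neg (not_le.2 hl), ite_self]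
  · lift l to ℕ using hl
    obtain ⟨N, hN, h⟩ :=
      ((eventually_sugawara_eq (phi l vac)).and (Filter.eventually_ge_atTop l)).exists
    have h1 : ∀ i : ℕ, leftVac (phi m (raise i (opH i (phi l vac)))) =
        -if m + l = 0 then propagator (l - (2 * i + 1)) else 0 := by
      intro i
      rw [opH_phi, opH_vac, map_zero, zero_add, eq_sub_of_add_eq (raise_phi i m _).symm, map_sub,
        leftVac_raise, leftVac_phi_phi, zero_sub]
      congr 2
      rw [eq_iff_iff]
      omega
    rw [hN, sugawaraSum, LinearMap.sum_apply, map_sum, map_sum]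
    simp only [Module.End.mul_apply, h1]
    rw [Finset.sum_neg_distrib]
    split
    · rw [sum_propagator h, neg_neg, if_pos (by omega)]
      simp
    · simp

/-- By the vanishing of the triple bracket this operator commutes with every fermion, so it is the
scalar found from its vacuum expectation. -/
theorem anticommPhi_commPhi_sugawara (m l : ℤ) : anticommPhi l (commPhi m sugawara) =
    (if m + l = 0 then (-1 : ℂ) ^ m * m / 2 else 0) • 1 := by
  set κ : ℂ := if m + l = 0 then (-1 : ℂ) ^ m * m / 2 else 0 with hκ
  have key : ∀ (j : ℤ) v, (anticommPhi l (commPhi m sugawara) - κ • 1) (phi j v) =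
      (1 : ℂ) • phi j ((anticommPhi l (commPhi m sugawara) - κ • 1) v) := by
    intro j v
    have h := congrArg (fun T : Module.End ℂ Fock => T v) (triple_comm_sugawara m l j)
    simp only [commPhi_apply j, LinearMap.zero_apply] at h
    simp only [LinearMap.sub_apply, LinearMap.smul_apply, Module.End.one_apply, map_sub, map_smul]
    linear_combination (norm := module) h
  refine sub_eq_zero.1 (eq_zero_of_commute key ?_)
  refine eq_zero_of_phi_neg (fun m hm => phi_vac_of_commute one_ne_zero key hm) ?_ ?_
  · simp only [LinearMap.sub_apply, anticommPhi_apply, commPhi_apply, LinearMap.smul_apply,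
      Module.End.one_apply, map_sub, map_add, map_smul, leftVac_sugawara, sugawara_vac, map_zero,
      leftVac_phi_sugawara_phi, leftVac_vac, smul_eq_mul, hκ, add_comm l m]
    by_cases h : m + l = 0
    · obtain rfl : l = -m := by omega
      rw [if_pos h, if_pos h, if_pos h, neg_one_zpow_congr (m := -m) (n := m) ⟨0, by ring⟩]
      rcases lt_trichotomy m 0 with h0 | rfl | h0
      · rw [if_pos (by omega), if_neg (by omega)]; push_cast; ring
      · simp
      · rw [if_neg (by omega), if_pos (by omega)]; ring
    · rw [if_neg h, if_neg h, if_neg h]; ring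
  · refine leftVac_phi_zero_of_parity ?_
    simp only [LinearMap.sub_apply, anticommPhi_apply, commPhi_apply, LinearMap.smul_apply,
      Module.End.one_apply, map_sub, map_add, map_smul, parity_sugawara, parity_phi, parity_vac,
      map_neg, neg_neg]

/-- By the double bracket, [S, φ_m] - (m/2) φ_m anticommutes with every fermion, and the vacuum test
with ε = -1 shows that it is zero. -/
theorem sugawara_phi (m : ℤ) (v : Fock) :
    sugawara (phi m v) = phi m (sugawara v) + ((m : ℂ) / 2) • phi m v := by
  have key : ∀ (l : ℤ) v, (commPhi m sugawara - ((m : ℂ) / 2) • phi m) (phi l v) =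
      (-1 : ℂ) • phi l ((commPhi m sugawara - ((m : ℂ) / 2) • phi m) v) := by
    intro l v
    have h := congrArg (fun T : Module.End ℂ Fock => T v) (anticommPhi_commPhi_sugawara m l)
    simp only [anticommPhi_apply l, LinearMap.smul_apply, Module.End.one_apply] at h
    have h1 := phi_phi m l v
    have h2 : (if m + l = 0 then (-1 : ℂ) ^ m * m / 2 else 0) =
        (m : ℂ) / 2 * if m = -l then (-1 : ℂ) ^ m else 0 := by
      by_cases hm : m + l = 0
      · rw [if_pos hm, if_pos (by omega)]; ring
      · rw [if_neg hm, if_neg (by omega), mul_zero]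
    rw [h2] at h
    simp only [LinearMap.sub_apply, LinearMap.smul_apply, map_sub, map_smul]
    linear_combination (norm := module) h - ((m : ℂ) / 2) • h1
  have h0 : commPhi m sugawara - ((m : ℂ) / 2) • phi m = 0 := by
    refine eq_zero_of_commute key ?_
    refine eq_zero_of_phi_neg (fun m hm => phi_vac_of_commute (by norm_num) key hm) ?_ ?_
    · simp only [LinearMap.sub_apply, commPhi_apply, LinearMap.smul_apply, map_sub, map_smul,
        leftVac_sugawara, sugawara_vac, map_zero, sub_zero, zero_sub, smul_eq_mul]
      rcases lt_trichotomy m 0 with h0 | rfl | h0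
      · rw [phi_vac m h0]; simp
      · simp
      · rw [leftVac_phi m h0]; simp
    · simp only [LinearMap.sub_apply, commPhi_apply, LinearMap.smul_apply, map_sub, map_smul,
        leftVac_phi_sugawara_phi, leftVac_phi_phi, sugawara_vac, map_zero, sub_zero, smul_eq_mul,
        zero_add]
      by_cases hm : m = 0
      · subst hm; simp
      · rw [if_neg hm, if_neg hm]; ring
  have h1 := congrArg (fun T : Module.End ℂ Fock => T v) h0
  simp only [LinearMap.sub_apply, LinearMap.smul_apply, commPhi_apply, LinearMap.zero_apply] at h1
  linear_combination (norm := module) h1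

theorem sugawara_wedge {l : List ℕ} (h : l.Pairwise (· > ·)) :
    sugawara (wedge l) = ((l.sum : ℂ) / 2) • wedge l := by
  induction l with
  | nil => simp [wedge_nil, sugawara_vac]
  | cons n l ih =>
    rw [wedge_cons_of_sorted h, sugawara_phi, ih (List.pairwise_cons.1 h).2, map_smul,
      List.sum_cons]
    push_cast
    module

theorem sugawara_monomial (s : Finset ℕ) :
    sugawara (monomial s) = (((∑ n ∈ s, n : ℕ) : ℂ) / 2) • monomial s := by
  rw [monomial, sugawara_wedge (sort_pairwise_gt s)]
  congr 3
  have h := List.sum_toFinset (fun n : ℕ => n) (Finset.sort_nodup s (fun a b => a ≥ b))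
  rw [Finset.sort_toFinset, List.map_id'] at h
  exact_mod_cast h.symm

/-- In the even part of the Fock space, only multiples of the vacuum are annihilated by all
`H_k`. -/
theorem eq_zero_of_opH_eq_zero {v : Fock} (hp : parity v = v) (h : ∀ i, opH i v = 0)
    (h0 : leftVac v = 0) : v = 0 := by
  refine eq_zero_of_form_monomial fun s => ?_
  have hs : sugawara v = 0 := by
    obtain ⟨N, hN⟩ := (eventually_sugawara_eq v).exists
    rw [hN]
    simp [sugawaraSum, h]
  -- The eigenvalue is half the weight of s, so only weight 0 can pair nontrivially with v. That
  -- leaves 1 and e_0, and evenness of v excludes e_0.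
  have h1 := form_monomial_diagonal sugawara_monomial s v
  rw [hs, map_zero, eq_comm, mul_eq_zero] at h1
  rcases h1 with h1 | h1
  · have h2 : ∀ n ∈ s, n = 0 := by
      have : ∑ n ∈ s, n = 0 := by
        have h3 : ((∑ n ∈ s, n : ℕ) : ℂ) = 0 := by simpa using h1
        exact_mod_cast h3
      exact Finset.sum_eq_zero_iff.1 this
    rcases Finset.subset_singleton_iff.1 (fun n hn => Finset.mem_singleton.2 (h2 n hn)) with
      rfl | rfl
    · rw [monomial, Finset.sort_empty, wedge_nil, form_vac, h0]
    · rw [monomial, Finset.sort_singleton, wedge_cons_of_sorted (by simp), wedge_nil, form_phi,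
        form_vac, Nat.cast_zero, neg_zero, leftVac_phi_zero_of_parity hp, mul_zero]
  · exact h1

/-! ### Dilations and weights -/

/-- The product `r(1) ⋯ r(n)`. -/
def prodR (r : ℤ → ℂ) (n : ℕ) : ℂ := ∏ j ∈ Finset.Icc 1 n, r (j : ℤ)

theorem prodR_zero (r : ℤ → ℂ) : prodR r 0 = 1 := by simp [prodR]

theorem prodR_add (r : ℤ → ℂ) (a k : ℕ) :
    prodR r (a + k) = prodR r a * ∏ j ∈ Finset.range k, r ((a : ℤ) + k - j) := by
  induction k with
  | zero => simp
  | succ k ih =>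
    rw [← add_assoc, prodR, Finset.prod_Icc_succ_top (by omega), ← prodR, ih,
      Finset.prod_range_succ', mul_assoc]
    congr 2
    · refine Finset.prod_congr rfl fun j _ => congrArg r ?_
      push_cast; ring

/-- The algebra endomorphism `e_n ↦ r(1) ⋯ r(n) e_n` of the Fock space. -/
def dilateHom (r : ℤ → ℂ) : Fock →ₐ[ℂ] Fock :=
  ExteriorAlgebra.map (Finsupp.linearCombination ℂ fun n => Finsupp.single n (prodR r n))

/-- The linear map underlying `dilateHom`. -/
def dilate (r : ℤ → ℂ) : Module.End ℂ Fock := (dilateHom r).toLinearMap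

theorem dilate_vac (r : ℤ → ℂ) : dilate r vac = vac := map_one (dilateHom r)

theorem dilate_create (r : ℤ → ℂ) (n : ℕ) (v : Fock) :
    dilate r (create n v) = prodR r n • create n (dilate r v) := by
  change dilateHom r (gen n * v) = prodR r n • (gen n * dilateHom r v)
  rw [map_mul, ← smul_mul_assoc]
  congr 1
  rw [gen, dilateHom, ExteriorAlgebra.map_apply_ι, ← map_smul]
  simp

theorem annih_dilate (r : ℤ → ℂ) (n : ℕ) (v : Fock) :
    annih n (dilate r v) = prodR r n • dilate r (annih n v) := by
  induction v using fock_induction with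
  | hvac => rw [dilate_vac, annih_vac, map_zero, smul_zero]
  | hadd v w hv hw => simp only [map_add, hv, hw, smul_add]
  | hsmul a v hv => simp only [map_smul, hv, smul_comm a]
  | hcreate m v hv =>
    rw [dilate_create, map_smul, annih_create_apply, annih_create_apply, hv, map_sub, dilate_create,
      map_smul]
    by_cases h : n = m
    · subst h
      rw [if_pos rfl, if_pos rfl]
    · rw [if_neg h, if_neg h, map_zero]
      module

theorem dilate_phi_natCast (r : ℤ → ℂ) (n : ℕ) (v : Fock) :
    dilate r (phi n v) = prodR r n • phi n (dilate r v) := by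
  rcases Nat.eq_zero_or_pos n with rfl | hn
  · simp [phi_zero, dilate_create, annih_dilate, prodR_zero]
  · rw [phi_natCast hn, dilate_create]

theorem phi_neg_dilate (r : ℤ → ℂ) (n : ℕ) (v : Fock) :
    phi (-n) (dilate r v) = prodR r n • dilate r (phi (-n) v) := by
  rcases Nat.eq_zero_or_pos n with rfl | hn
  · simp [phi_zero, dilate_create, annih_dilate, prodR_zero]
  · rw [phi_neg_natCast hn, LinearMap.smul_apply, annih_dilate, LinearMap.smul_apply, map_smul,
      smul_comm]

/-- With n = -a, φ_{k+a} gains r(1)⋯r(a+k) and φ_{-a} accounts for r(1)⋯r(a); their quotient is the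
reflected window. Nothing is divided, so r may vanish. -/
theorem dilate_phi_phi_of_neg {r : ℤ → ℂ} (hr : ∀ n : ℤ, r n = r (1 - n)) (k : ℕ) (hk : 0 < k) {n : ℤ}
    (hn : n < 0) (v : Fock) : (∏ j ∈ Finset.range k, r (n - j)) • phi n (phi (k - n) (dilate r v)) =
      dilate r (phi n (phi (k - n) v)) := by
  lift -n to ℕ using by omega with a ha
  obtain rfl : n = -(a : ℤ) := by omega
  have e : (k : ℤ) - -(a : ℤ) = ((a + k : ℕ) : ℤ) := by push_cast; ring
  rw [← prod_reflect hr, e, phi_phi_of_ne (m := -a) (by omega), phi_phi_of_ne (m := -a) (by omega),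
    phi_neg_dilate, map_neg, dilate_phi_natCast, prodR_add, map_smul]
  push_cast
  module

/-- The case n > k is the case n < 0 with the factors exchanged. For 0 ≤ n ≤ k the window splits at
1: its upper part is r(1)⋯r(n), and its lower part reflects to r(1)⋯r(k-n). -/
theorem dilate_phi_phi {r : ℤ → ℂ} (hr : ∀ n : ℤ, r n = r (1 - n)) (k : ℕ) (hk : 0 < k) (n : ℤ)
    (v : Fock) : (∏ j ∈ Finset.range k, r (n - j)) • phi n (phi (k - n) (dilate r v)) =
      dilate r (phi n (phi (k - n) v)) := by
  rcases lt_or_ge n 0 with hn | hn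
  · exact dilate_phi_phi_of_neg hr k hk hn v
  · rcases lt_or_ge (k : ℤ) n with hkn | hkn
    · have h := dilate_phi_phi_of_neg hr k hk (n := k - n) (by omega) v
      rw [prod_reflect hr, show (k : ℤ) - (k - n) = n by ring] at h
      rw [phi_phi_of_ne (m := n) (by omega), phi_phi_of_ne (m := n) (by omega), smul_neg, map_neg, h]
    · lift n to ℕ using hn
      obtain ⟨b, rfl⟩ : ∃ b, k = n + b := ⟨k - n, by omega⟩
      have e : ((n + b : ℕ) : ℤ) - n = b := by push_cast; ring
      have h1 := prodR_add r 0 n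
      have h2 := prodR_add r 0 b
      have h3 := prod_reflect hr b 0
      simp only [Nat.cast_zero, zero_add, prodR_zero, one_mul, sub_zero] at h1 h2 h3
      rw [e, dilate_phi_natCast, dilate_phi_natCast, map_smul, smul_smul, Finset.prod_range_add,
        ← h1, h2, h3]
      congr 2
      refine Finset.prod_congr rfl fun j _ => congrArg r ?_
      push_cast; ring

/-- The dilation intertwines the operators `B_k` for `r` with those for `r = 1`. -/
theorem opB_dilate {r : ℤ → ℂ} (hr : ∀ n : ℤ, r n = r (1 - n)) (i : ℕ) (v : Fock) :
    opB r i (dilate r v) = -dilate r (raise i v) := by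
  rw [raise, map_quadratic, opB, quadratic_apply, ← finsum_neg_distrib]
  refine finsum_congr fun n => ?_
  have h := dilate_phi_phi hr (2 * i + 1) (by omega) n v
  push_cast at h
  rw [← h, neg_one_zpow_eq_neg (m := n + 1) (n := n) ⟨n, by ring⟩]
  module

theorem dilate_wedge (r : ℤ → ℂ) (l : List ℕ) :
    dilate r (wedge l) = (l.map (prodR r)).prod • wedge l := by
  induction l with
  | nil => simp [wedge_nil, dilate_vac]
  | cons n l ih => rw [wedge_cons, dilate_create, ih, map_smul, smul_smul, List.map_cons,
      List.prod_cons]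

theorem dilate_monomial (r : ℤ → ℂ) (s : Finset ℕ) :
    dilate r (monomial s) = (∏ n ∈ s, prodR r n) • monomial s := by
  rw [monomial, dilate_wedge, ← List.prod_toFinset _ (Finset.sort_nodup _ _),
    Finset.sort_toFinset]

/-- The vector `v` is homogeneous of weight `n`, where `e_m` has weight `m`. -/
def HasWeight (n : ℤ) (v : Fock) : Prop := dilate (fun _ => 2) v = (2 : ℂ) ^ n • v

theorem prodR_two (n : ℕ) : prodR (fun _ => 2) n = 2 ^ n := by simp [prodR]

theorem dilate_two_phi (m : ℤ) (v : Fock) :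
    dilate (fun _ => 2) (phi m v) = (2 : ℂ) ^ m • phi m (dilate (fun _ => 2) v) := by
  rcases le_total 0 m with h | h
  · lift m to ℕ using h
    rw [dilate_phi_natCast, prodR_two, zpow_natCast]
  · lift -m to ℕ using by omega with n hn
    obtain rfl : m = -(n : ℤ) := by omega
    rw [phi_neg_dilate, prodR_two, smul_smul, zpow_neg, zpow_natCast, inv_mul_cancel₀ (by simp),
      one_smul]

theorem hasWeight_phi {n : ℤ} {v : Fock} (h : HasWeight n v) (m : ℤ) :
    HasWeight (m + n) (phi m v) := by
  rw [HasWeight, dilate_two_phi, h, map_smul, smul_smul, zpow_add₀ two_ne_zero]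

theorem hasWeight_annih {n : ℤ} {v : Fock} (h : HasWeight n v) (m : ℕ) :
    HasWeight (n - m) (annih m v) := by
  have h1 := annih_dilate (fun _ => 2) m v
  rw [h, prodR_two, map_smul] at h1
  rw [HasWeight, zpow_sub₀ two_ne_zero, zpow_natCast, div_eq_inv_mul, mul_smul, h1, smul_smul,
    inv_mul_cancel₀ (by simp), one_smul]

theorem hasWeight_opH {n : ℤ} {v : Fock} (h : HasWeight n v) (i : ℕ) :
    HasWeight (n - (2 * i + 1)) (opH i v) := by
  rw [HasWeight, opH, map_quadratic, quadratic_apply,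
    smul_finsum' _ (finite_support_quadratic _ _ (by omega) v)]
  refine finsum_congr fun m => ?_
  have h1 : HasWeight (n - (2 * i + 1)) (phi m (phi (-(2 * (i : ℤ) + 1) - m) v)) := by
    have h2 := hasWeight_phi (hasWeight_phi h (-(2 * (i : ℤ) + 1) - m)) m
    rwa [show m + (-(2 * (i : ℤ) + 1) - m + n) = n - (2 * i + 1) by ring] at h2
  rw [h1, smul_comm]

theorem hasWeight_wedge (l : List ℕ) : HasWeight l.sum (wedge l) := by
  rw [HasWeight, dilate_wedge]
  congr 1
  induction l with
  | nil => simp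
  | cons n l ih =>
    rw [List.map_cons, List.prod_cons, ih, prodR_two, List.sum_cons, Nat.cast_add,
      zpow_add₀ two_ne_zero, zpow_natCast 2 n]

/-- The doubling dilation has eigenvalues at least 1 on monomials, whereas 2^n < 1. -/
theorem eq_zero_of_hasWeight_neg {n : ℤ} {v : Fock} (hn : n < 0) (h : HasWeight n v) : v = 0 := by
  refine eq_zero_of_form_monomial fun s => ?_
  have h1 := form_monomial_diagonal (dilate_monomial fun _ => 2) s v
  rw [h, map_smul, smul_eq_mul, ← sub_eq_zero, ← sub_mul, mul_eq_zero] at h1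
  refine h1.resolve_left fun h2 => ?_
  have h3 : (2 : ℝ) ^ n = 2 ^ ∑ i ∈ s, i := by
    rw [sub_eq_zero] at h2
    rw [Finset.prod_congr rfl fun i _ => prodR_two i, Finset.prod_pow_eq_pow_sum] at h2
    simpa using congrArg norm h2
  have h4 : (2 : ℝ) ^ n < 1 := zpow_lt_one_of_neg₀ one_lt_two hn
  have h5 : (1 : ℝ) ≤ 2 ^ ∑ i ∈ s, i := one_le_pow₀ one_le_two
  linarith

/-! ### Polynomials in commuting operators -/

/-- Commuting operators generate a commutative algebra, in which polynomials can be evaluated and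
the ordered products are ordinary ones. -/
theorem exists_evalOp_algHom {T : ℕ → Module.End ℂ Fock} (hT : ∀ i j, Commute (T i) (T j)) :
    ∃ M : Poly →ₐ[ℂ] Module.End ℂ Fock, (∀ i, M (MvPolynomial.X i) = T i) ∧
      ∀ f, evalOp T f = M f := by
  have : IsMulCommutative (Algebra.adjoin ℂ (Set.range T)) := Algebra.isMulCommutative_adjoin ℂ (by
    rintro _ ⟨i, rfl⟩ _ ⟨j, rfl⟩
    exact hT i j)
  let _ : CommRing (Algebra.adjoin ℂ (Set.range T)) :=
    { (inferInstance : Ring (Algebra.adjoin ℂ (Set.range T))) with mul_comm := mul_comm' }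
  set N : Poly →ₐ[ℂ] Algebra.adjoin ℂ (Set.range T) :=
    MvPolynomial.aeval fun i => ⟨T i, Algebra.subset_adjoin ⟨i, rfl⟩⟩
  refine ⟨(Algebra.adjoin ℂ (Set.range T)).val.comp N, fun i => ?_, fun f => ?_⟩
  · simp [N]
  · conv_rhs => rw [← MvPolynomial.support_sum_monomial_coeff f]
    rw [map_sum, evalOp]
    refine Finset.sum_congr rfl fun m _ => ?_
    rw [AlgHom.comp_apply, MvPolynomial.aeval_monomial, ← Algebra.smul_def, map_smul]
    congr 1
    rw [Finsupp.prod, ← Finset.sort_toFinset (s := m.support) (r := (· ≤ ·)),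
      List.prod_toFinset _ (Finset.sort_nodup _ _), map_list_prod, List.map_map,
      Finset.sort_toFinset]
    rfl

/-- Substitution of commuting operators as an algebra homomorphism. -/
def evalHom (T : ℕ → Module.End ℂ Fock) (hT : ∀ i j, Commute (T i) (T j)) :
    Poly →ₐ[ℂ] Module.End ℂ Fock := (exists_evalOp_algHom hT).choose

theorem evalHom_X {T : ℕ → Module.End ℂ Fock} (hT : ∀ i j, Commute (T i) (T j)) (i : ℕ) :
    evalHom T hT (MvPolynomial.X i) = T i := (exists_evalOp_algHom hT).choose_spec.1 i

theorem evalOp_eq {T : ℕ → Module.End ℂ Fock} (hT : ∀ i j, Commute (T i) (T j)) (f : Poly) :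
    evalOp T f = evalHom T hT f := (exists_evalOp_algHom hT).choose_spec.2 f

theorem commute_halfH (i j : ℕ) : Commute (halfH i) (halfH j) :=
  ((commute_opH i j).smul_left _).smul_right _

theorem commute_neg_halfB {r : ℤ → ℂ} (hr : ∀ n : ℤ, r n = r (1 - n)) (i j : ℕ) :
    Commute (-halfB r i) (-halfB r j) :=
  Commute.neg_left (Commute.neg_right (((commute_opB hr i j).smul_left _).smul_right _))

/-- Substitution of `H_n / n` for the variables. -/
def lowerHom : Poly →ₐ[ℂ] Module.End ℂ Fock := evalHom halfH commute_halfH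

/-- Substitution of `-B_n / n`, `r = 1`, for the variables. -/
def raiseHom : Poly →ₐ[ℂ] Module.End ℂ Fock :=
  evalHom (fun i => (2 * (i : ℂ) + 1)⁻¹ • raise i) fun i j =>
    ((commute_raise i j).smul_left _).smul_right _

theorem lowerHom_X (i : ℕ) : lowerHom (MvPolynomial.X i) = (2 * (i : ℂ) + 1)⁻¹ • opH i :=
  evalHom_X _ i

theorem raiseHom_X (i : ℕ) : raiseHom (MvPolynomial.X i) = (2 * (i : ℂ) + 1)⁻¹ • raise i :=
  evalHom_X _ i

theorem raiseHom_mul_X (f : Poly) (i : ℕ) (v : Fock) : raiseHom (f * MvPolynomial.X i) v =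
    (2 * (i : ℂ) + 1)⁻¹ • raiseHom f (raise i v) := by
  rw [map_mul, raiseHom_X, Module.End.mul_apply, LinearMap.smul_apply, map_smul]

theorem raiseHom_C (a : ℂ) (v : Fock) : raiseHom (MvPolynomial.C a) v = a • v := by
  rw [← MvPolynomial.algebraMap_eq, AlgHom.commutes, Module.algebraMap_end_apply]

theorem two_mul_add_one_ne_zero (i : ℕ) : (2 * (i : ℂ) + 1) ≠ 0 := by
  exact_mod_cast Nat.succ_ne_zero (2 * i)

/-- `H_k` acts on polynomials in the `-B_n / n` as a derivation. -/
theorem opH_raiseHom (i : ℕ) (f : Poly) (v : Fock) : opH i (raiseHom f v) =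
    raiseHom f (opH i v) + (1 / 2 : ℂ) • raiseHom (MvPolynomial.pderiv i f) v := by
  induction f using MvPolynomial.induction_on generalizing v with
  | C a => simp
  | add p q hp hq =>
    simp only [map_add, LinearMap.add_apply, hp, hq]
    module
  | mul_X p j hp =>
    rw [Derivation.leibniz, MvPolynomial.pderiv_X, raiseHom_mul_X, map_smul, hp, opH_raise,
      raiseHom_mul_X, smul_eq_mul, smul_eq_mul, mul_comm (MvPolynomial.X j), map_add raiseHom,
      LinearMap.add_apply, raiseHom_mul_X, map_add, map_smul]
    by_cases h : i = j
    · subst h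
      -- The central term k/2 times the normalization 1/k gives the factor ½.
      have h2 := mul_inv_cancel₀ (two_mul_add_one_ne_zero i)
      rw [if_pos rfl, Pi.single_eq_same, mul_one]
      linear_combination (norm := module) (1 / 2 : ℂ) • congrArg (fun c : ℂ => c • raiseHom p v) h2
    · rw [if_neg h, Pi.single_eq_of_ne' h, mul_zero, map_zero, LinearMap.zero_apply]
      module

theorem leftVac_raiseHom (f : Poly) (v : Fock) :
    leftVac (raiseHom f v) = MvPolynomial.constantCoeff f * leftVac v := by
  induction f using MvPolynomial.induction_on generalizing v with
  | C a => simp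
  | add p q hp hq => simp only [map_add, LinearMap.add_apply, hp, hq, add_mul]
  | mul_X p j hp =>
    rw [raiseHom_mul_X, map_smul, hp, leftVac_raise, map_mul, MvPolynomial.constantCoeff_X]
    simp

theorem parity_raiseHom (f : Poly) (v : Fock) :
    parity (raiseHom f v) = raiseHom f (parity v) := by
  induction f using MvPolynomial.induction_on generalizing v with
  | C a => simp
  | add p q hp hq => simp only [map_add, LinearMap.add_apply, hp, hq]
  | mul_X p j hp => simp only [raiseHom_mul_X, map_smul, hp, parity_raise]

theorem form_raiseHom (f : Poly) (u v : Fock) :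
    form (raiseHom f u) v = form u (lowerHom f v) := by
  induction f using MvPolynomial.induction_on generalizing u v with
  | C a =>
    rw [raiseHom_C, ← MvPolynomial.algebraMap_eq, AlgHom.commutes, Module.algebraMap_end_apply]
    simp
  | add p q hp hq => simp only [map_add, LinearMap.add_apply, hp, hq]
  | mul_X p j hp =>
    rw [raiseHom_mul_X, map_smul, LinearMap.smul_apply, hp, form_raise, mul_comm p, map_mul,
      lowerHom_X, Module.End.mul_apply, LinearMap.smul_apply, map_smul]

theorem evalHom_neg_halfB_dilate {r : ℤ → ℂ} (hr : ∀ n : ℤ, r n = r (1 - n)) (f : Poly) (v : Fock) :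
    evalHom _ (commute_neg_halfB hr) f (dilate r v) = dilate r (raiseHom f v) := by
  induction f using MvPolynomial.induction_on generalizing v with
  | C a =>
    rw [raiseHom_C, ← MvPolynomial.algebraMap_eq, AlgHom.commutes, Module.algebraMap_end_apply,
      map_smul]
  | add p q hp hq => simp only [map_add, LinearMap.add_apply, hp, hq]
  | mul_X p j hp =>
    rw [raiseHom_mul_X, map_smul, ← hp, map_mul, evalHom_X, Module.End.mul_apply,
      LinearMap.neg_apply, halfB, LinearMap.smul_apply, opB_dilate hr, smul_neg, neg_neg, map_smul]

/-- In characteristic 0 each coefficient is, up to a nonzero factor, the constant term of an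
iterated derivative. -/
theorem eq_zero_of_pderiv {p : Poly → Prop} (hp : ∀ f i, p f → p (MvPolynomial.pderiv i f))
    (h0 : ∀ f, p f → MvPolynomial.constantCoeff f = 0) {f : Poly} (hf : p f) : f = 0 := by
  ext m
  rw [MvPolynomial.coeff_zero]
  induction hn : m.degree generalizing f m with
  | zero =>
    rw [(Finsupp.degree_eq_zero_iff m).1 hn]
    exact h0 f hf
  | succ n ih =>
    obtain ⟨i, hi⟩ : ∃ i, m i ≠ 0 := by
      by_contra! h
      rw [show m = 0 from Finsupp.ext h, map_zero] at hn
      omega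
    have hm : m - Finsupp.single i 1 + Finsupp.single i 1 = m := by
      refine tsub_add_cancel_of_le ?_
      rw [Finsupp.single_le_iff]
      omega
    have h1 := ih (hp f i hf) (m - Finsupp.single i 1) (by
      have h2 := congrArg Finsupp.degree hm
      rw [map_add, Finsupp.degree_single, hn] at h2
      omega)
    rw [MvPolynomial.coeff_pderiv, hm] at h1
    exact (mul_eq_zero.1 h1).resolve_right (Nat.cast_add_one_ne_zero _)

/-- The kernel is stable under derivatives, since H_k acts as ½ ∂, and ⟨0| reads off the constant
term. -/
theorem raiseHom_vac_injective {f : Poly} (h : raiseHom f vac = 0) : f = 0 := by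
  refine eq_zero_of_pderiv (p := fun f => raiseHom f vac = 0) (fun f i hf => ?_) (fun f hf => ?_) h
  · have h1 := opH_raiseHom i f vac
    rw [hf, opH_vac, map_zero, map_zero, zero_add] at h1
    exact (smul_eq_zero.1 h1.symm).resolve_left (by norm_num)
  · have h1 := leftVac_raiseHom f vac
    rwa [hf, map_zero, leftVac_vac, mul_one, eq_comm] at h1

/-! ### The polynomials `q_k` and `Q_{(m,n)}` -/

theorem X_dvd_xi : PowerSeries.X ∣ xi := by
  rw [PowerSeries.X_dvd_iff, ← PowerSeries.coeff_zero_eq_constantCoeff_apply, xi,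
    PowerSeries.coeff_mk, if_neg (by decide)]

theorem coeff_xi_pow_eq_zero {n j : ℕ} (h : n < j) : PowerSeries.coeff n (xi ^ j) = 0 :=
  PowerSeries.X_pow_dvd_iff.1 (pow_dvd_pow_of_dvd X_dvd_xi j) n h

/-- Since ξ has no constant term, any cutoff beyond n yields the same coefficient. -/
theorem q_eq_sum {n N : ℕ} (h : n < N) :
    q n = ∑ j ∈ Finset.range N, ((j.factorial : ℂ)⁻¹) • PowerSeries.coeff n (xi ^ j) := by
  have h1 : q n = ∑ j ∈ Finset.range ((Finsupp.single () n).degree + 1),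
      ((j.factorial : ℂ)⁻¹) • PowerSeries.coeff n (xi ^ j) := rfl
  rw [h1, Finsupp.degree_single]
  refine Finset.sum_subset (fun j hj => ?_) fun j _ hj => ?_
  · rw [Finset.mem_range] at hj ⊢; omega
  · rw [coeff_xi_pow_eq_zero (by simpa using hj), smul_zero]

/-- The coefficientwise partial derivative of a power series. -/
def coeffPderiv (i : ℕ) (F : PowerSeries Poly) : PowerSeries Poly :=
  PowerSeries.mk fun n => MvPolynomial.pderiv i (PowerSeries.coeff n F)

theorem coeff_coeffPderiv (i : ℕ) (F : PowerSeries Poly) (n : ℕ) :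
    PowerSeries.coeff n (coeffPderiv i F) = MvPolynomial.pderiv i (PowerSeries.coeff n F) :=
  PowerSeries.coeff_mk _ _

theorem coeffPderiv_mul (i : ℕ) (F G : PowerSeries Poly) :
    coeffPderiv i (F * G) = F * coeffPderiv i G + coeffPderiv i F * G := by
  refine PowerSeries.ext fun n => ?_
  rw [coeff_coeffPderiv, map_add, PowerSeries.coeff_mul, PowerSeries.coeff_mul,
    PowerSeries.coeff_mul, map_sum, ← Finset.sum_add_distrib]
  refine Finset.sum_congr rfl fun p _ => ?_
  rw [Derivation.leibniz, coeff_coeffPderiv, coeff_coeffPderiv, smul_eq_mul, smul_eq_mul]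
  ring

theorem coeffPderiv_xi (i : ℕ) : coeffPderiv i xi = 2 * PowerSeries.X ^ (2 * i + 1) := by
  refine PowerSeries.ext fun n => ?_
  rw [coeff_coeffPderiv, xi, PowerSeries.coeff_mk, ← map_ofNat (PowerSeries.C (R := Poly)) 2,
    PowerSeries.coeff_C_mul, PowerSeries.coeff_X_pow]
  by_cases hn : Odd n
  · rw [if_pos hn, Derivation.leibniz, MvPolynomial.pderiv_X]
    obtain ⟨m, rfl⟩ := hn
    rw [show (2 * m + 1) / 2 = m by omega]
    by_cases h : i = m
    · subst h
      have : MvPolynomial.pderiv i (2 : Poly) = 0 := by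
        rw [← map_ofNat (MvPolynomial.C (R := ℂ) (σ := ℕ)) 2, MvPolynomial.pderiv_C]
      simp [this]
    · have : MvPolynomial.pderiv i (2 : Poly) = 0 := by
        rw [← map_ofNat (MvPolynomial.C (R := ℂ) (σ := ℕ)) 2, MvPolynomial.pderiv_C]
      rw [if_neg (by omega), Pi.single_eq_of_ne' h, this]
      simp
  · rw [if_neg hn, if_neg (fun h => hn ⟨i, h⟩), map_zero, mul_zero]

theorem coeffPderiv_xi_pow (i j : ℕ) : coeffPderiv i (xi ^ (j + 1)) =
    ((j : PowerSeries Poly) + 1) * (2 * (xi ^ j * PowerSeries.X ^ (2 * i + 1))) := by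
  induction j with
  | zero => rw [zero_add, pow_one, coeffPderiv_xi]; simp
  | succ j ih =>
    rw [pow_succ xi (j + 1), coeffPderiv_mul, ih, coeffPderiv_xi]
    push_cast
    ring

/-- Differentiating exp ξ multiplies it by 2 z^{2i+1}; term j + 1 of the exponential series passes
to term j. -/
theorem pderiv_q (i n : ℕ) :
    MvPolynomial.pderiv i (q n) = if 2 * i + 1 ≤ n then 2 * q (n - (2 * i + 1)) else 0 := by
  rw [q_eq_sum (show n < (n + 1) + 1 by omega), Finset.sum_range_succ', map_add, map_sum]
  have h0 : MvPolynomial.pderiv i ((((0 : ℕ).factorial : ℂ)⁻¹) •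
      PowerSeries.coeff n (xi ^ 0)) = 0 := by
    rw [pow_zero, PowerSeries.coeff_one]
    split <;> simp
  have h1 : ∀ j : ℕ, MvPolynomial.pderiv i ((((j + 1).factorial : ℂ)⁻¹) •
      PowerSeries.coeff n (xi ^ (j + 1))) = if 2 * i + 1 ≤ n then
        2 * (((j.factorial : ℂ)⁻¹) • PowerSeries.coeff (n - (2 * i + 1)) (xi ^ j)) else 0 := by
    intro j
    have e : ((j : PowerSeries Poly) + 1) * (2 * (xi ^ j * PowerSeries.X ^ (2 * i + 1))) =
        PowerSeries.C (MvPolynomial.C (((j + 1 : ℕ) : ℂ) * 2)) *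
          (xi ^ j * PowerSeries.X ^ (2 * i + 1)) := by
      simp only [map_mul, map_natCast, map_ofNat]
      push_cast
      ring
    rw [Derivation.map_smul, ← coeff_coeffPderiv, coeffPderiv_xi_pow, e, PowerSeries.coeff_C_mul,
      PowerSeries.coeff_mul_X_pow']
    split
    · rw [← MvPolynomial.smul_eq_C_mul, smul_smul,
        ← map_ofNat (MvPolynomial.C (R := ℂ) (σ := ℕ)) 2, ← MvPolynomial.smul_eq_C_mul, smul_smul]
      congr 1
      have := Nat.cast_ne_zero (R := ℂ).2 (Nat.factorial_ne_zero j)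
      have := Nat.cast_ne_zero (R := ℂ).2 (Nat.succ_ne_zero j)
      rw [Nat.factorial_succ]
      push_cast at *
      field_simp
    · rw [mul_zero, smul_zero]
  rw [h0, add_zero, Finset.sum_congr rfl fun j _ => h1 j]
  split
  · rw [← Finset.mul_sum, ← q_eq_sum (by omega)]
  · simp

theorem constantCoeff_q (n : ℕ) : MvPolynomial.constantCoeff (q n) = if n = 0 then 1 else 0 := by
  have hxi : PowerSeries.map MvPolynomial.constantCoeff xi = 0 := by
    refine PowerSeries.ext fun n => ?_
    rw [PowerSeries.coeff_map, xi, PowerSeries.coeff_mk]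
    split <;> simp
  rw [q_eq_sum (Nat.lt_succ_self n), map_sum, Finset.sum_eq_single 0]
  · rw [pow_zero, PowerSeries.coeff_one]
    split <;> simp
  · intro j _ hj
    rw [MvPolynomial.constantCoeff_smul, ← PowerSeries.coeff_map, map_pow, hxi, zero_pow hj,
      map_zero, smul_zero]
  · simp

/-- The series `∑_k q_k z^k`. -/
def qSeries : PowerSeries Poly := PowerSeries.mk q

/-- The series `∑_k (-1)^k q_{x+k} z^k`. -/
def qAltSeries (x : ℕ) : PowerSeries Poly := PowerSeries.mk fun k => (-1) ^ k * q (x + k)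

theorem coeffPderiv_qSeries (i : ℕ) :
    coeffPderiv i qSeries = 2 * (PowerSeries.X ^ (2 * i + 1) * qSeries) := by
  refine PowerSeries.ext fun n => ?_
  rw [coeff_coeffPderiv, ← map_ofNat (PowerSeries.C (R := Poly)) 2,
    PowerSeries.coeff_C_mul, PowerSeries.coeff_X_pow_mul', qSeries, PowerSeries.coeff_mk,
    PowerSeries.coeff_mk, pderiv_q, mul_ite, mul_zero]

theorem pderiv_neg_one_pow_mul (i k : ℕ) (f : Poly) :
    MvPolynomial.pderiv i ((-1) ^ k * f) = (-1) ^ k * MvPolynomial.pderiv i f := by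
  rcases neg_one_pow_eq_or Poly k with h | h <;> simp [h]

theorem coeffPderiv_qAltSeries (i x : ℕ) : coeffPderiv i (qAltSeries x) =
    if 2 * i + 1 ≤ x then 2 * qAltSeries (x - (2 * i + 1)) else
      2 * (-1) ^ (2 * i + 1 - x) * (PowerSeries.X ^ (2 * i + 1 - x) * qAltSeries 0) := by
  refine PowerSeries.ext fun n => ?_
  rw [coeff_coeffPderiv, qAltSeries, PowerSeries.coeff_mk, pderiv_neg_one_pow_mul, pderiv_q]
  by_cases h : 2 * i + 1 ≤ x
  · rw [if_pos h, if_pos (by omega), ← map_ofNat (PowerSeries.C (R := Poly)) 2, PowerSeries.coeff_C_mul,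
      qAltSeries, PowerSeries.coeff_mk, show x + n - (2 * i + 1) = x - (2 * i + 1) + n by omega]
    ring
  · have e : (2 * (-1) ^ (2 * i + 1 - x) : PowerSeries Poly) =
        PowerSeries.C (2 * (-1) ^ (2 * i + 1 - x)) := by
      rw [map_mul, map_pow, map_neg, map_one, map_ofNat]
    rw [if_neg h, e, PowerSeries.coeff_C_mul, PowerSeries.coeff_X_pow_mul', qAltSeries, PowerSeries.coeff_mk]
    by_cases hn : 2 * i + 1 ≤ x + n
    · rw [if_pos hn, if_pos (by omega), zero_add,
        show x + n - (2 * i + 1) = n - (2 * i + 1 - x) by omega]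
      have : ((-1) ^ n : Poly) = (-1) ^ (2 * i + 1 - x) * (-1) ^ (n - (2 * i + 1 - x)) := by
        rw [← pow_add]; congr 1; omega
      rw [this]
      ring
    · rw [if_neg hn, if_neg (by omega), mul_zero, mul_zero]

/-- The relation `q(z) q(-z) = 1`. -/
theorem qAltSeries_zero_mul_qSeries : qAltSeries 0 * qSeries = 1 := by
  -- The factors contribute ±2 z^{2i+1} with opposite signs because the exponent is odd.
  have hd : ∀ i, coeffPderiv i (qAltSeries 0 * qSeries) = 0 := by
    intro i
    rw [coeffPderiv_mul, coeffPderiv_qSeries, coeffPderiv_qAltSeries, if_neg (by omega), Nat.sub_zero,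
      (show Odd (2 * i + 1) from ⟨i, rfl⟩).neg_one_pow]
    ring
  have hc : PowerSeries.map MvPolynomial.constantCoeff (qAltSeries 0 * qSeries) = 1 := by
    have h1 : PowerSeries.map MvPolynomial.constantCoeff (qAltSeries 0) = 1 := by
      refine PowerSeries.ext fun n => ?_
      rw [PowerSeries.coeff_map, qAltSeries, PowerSeries.coeff_mk, map_mul, constantCoeff_q,
        PowerSeries.coeff_one]
      by_cases hn : n = 0 <;> simp [hn]
    have h2 : PowerSeries.map MvPolynomial.constantCoeff qSeries = 1 := by
      refine PowerSeries.ext fun n => ?_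
      rw [PowerSeries.coeff_map, qSeries, PowerSeries.coeff_mk, constantCoeff_q,
        PowerSeries.coeff_one]
    rw [map_mul, h1, h2, mul_one]
  refine PowerSeries.ext fun n => sub_eq_zero.1 ?_
  refine eq_zero_of_pderiv (p := fun f => (∀ i, MvPolynomial.pderiv i f = 0) ∧
    MvPolynomial.constantCoeff f = 0) (fun f i hf => ?_) (fun f hf => hf.2) ⟨fun i => ?_, ?_⟩
  · rw [hf.1 i]
    simp
  · rw [map_sub, ← coeff_coeffPderiv, hd, map_zero, PowerSeries.coeff_one]
    split <;> simp
  · rw [map_sub, ← PowerSeries.coeff_map, hc, PowerSeries.coeff_one, PowerSeries.coeff_one]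
    split <;> simp

/-- `Q_{(x,y)}` is the coefficient of `z^y` in
`(2 ∑_k (-1)^k q_{x+k} z^k - q_x) ∑_k q_k z^k`. -/
theorem coeff_q₂_series (x y : ℕ) : PowerSeries.coeff y
    ((2 * qAltSeries x - PowerSeries.C (q x)) * qSeries) = q₂ x y := by
  rw [sub_mul, mul_assoc, map_sub, PowerSeries.coeff_C_mul, ← map_ofNat (PowerSeries.C (R := Poly)) 2,
    PowerSeries.coeff_C_mul, PowerSeries.coeff_mul, Finset.Nat.sum_antidiagonal_eq_sum_range_succ_mk,
    Finset.sum_range_succ', q₂]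
  have h : ∑ i ∈ Finset.Icc 1 y, (-1) ^ i * q (x + i) * q (y - i) =
      ∑ i ∈ Finset.range y, (-1) ^ (i + 1) * q (x + (i + 1)) * q (y - (i + 1)) := by
    rw [Finset.range_eq_Ico, Finset.sum_Ico_add' (fun i => (-1) ^ i * q (x + i) * q (y - i)) 0 y 1]
    rfl
  simp only [qAltSeries, qSeries, PowerSeries.coeff_mk, h, pow_zero, add_zero, Nat.sub_zero, one_mul]
  ring

/-- The derivative lowers x or y by k = 2i+1. When x would become negative, q(z) q(-z) = 1 collapses
the series to a single power of z, the counterpart of a contraction of fermions. -/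
theorem coeffPderiv_q₂_series (i x : ℕ) :
    coeffPderiv i ((2 * qAltSeries x - PowerSeries.C (q x)) * qSeries) =
      (if 2 * i + 1 ≤ x then 2 * ((2 * qAltSeries (x - (2 * i + 1)) -
        PowerSeries.C (q (x - (2 * i + 1)))) * qSeries)
      else 4 * (-1) ^ (2 * i + 1 - x) * PowerSeries.X ^ (2 * i + 1 - x)) +
      2 * (PowerSeries.X ^ (2 * i + 1) * ((2 * qAltSeries x - PowerSeries.C (q x)) * qSeries)) := by
  have h1 : coeffPderiv i (2 * qAltSeries x - PowerSeries.C (q x)) =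
      2 * coeffPderiv i (qAltSeries x) - PowerSeries.C (MvPolynomial.pderiv i (q x)) := by
    refine PowerSeries.ext fun n => ?_
    rw [coeff_coeffPderiv, map_sub, map_sub, map_sub, ← map_ofNat (PowerSeries.C (R := Poly)) 2,
      PowerSeries.coeff_C_mul, PowerSeries.coeff_C_mul, coeff_coeffPderiv, PowerSeries.coeff_C,
      PowerSeries.coeff_C, two_mul, two_mul, map_add]
    split <;> simp
  rw [coeffPderiv_mul, h1, coeffPderiv_qSeries, coeffPderiv_qAltSeries, pderiv_q]
  split
  · simp only [map_mul, map_ofNat]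
    ring
  · rw [map_zero]
    linear_combination (4 * (-1) ^ (2 * i + 1 - x) * PowerSeries.X ^ (2 * i + 1 - x)) *
      qAltSeries_zero_mul_qSeries

theorem pderiv_q₂ (i x y : ℕ) : MvPolynomial.pderiv i (q₂ x y) =
    (if 2 * i + 1 ≤ x then 2 * q₂ (x - (2 * i + 1)) y
      else if y = 2 * i + 1 - x then 4 * (-1) ^ (2 * i + 1 - x) else 0) +
      if 2 * i + 1 ≤ y then 2 * q₂ x (y - (2 * i + 1)) else 0 := by
  have e : (4 * (-1) ^ (2 * i + 1 - x) : PowerSeries Poly) =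
      PowerSeries.C (4 * (-1) ^ (2 * i + 1 - x)) := by
    rw [map_mul, map_pow, map_neg, map_one, map_ofNat]
  rw [← coeff_q₂_series, ← coeff_coeffPderiv, coeffPderiv_q₂_series, map_add, e,
    ← map_ofNat (PowerSeries.C (R := Poly)) 2, PowerSeries.coeff_C_mul,
    PowerSeries.coeff_X_pow_mul', mul_ite, mul_zero, map_ofNat, coeff_q₂_series]
  congr 1
  split
  · rw [← map_ofNat (PowerSeries.C (R := Poly)) 2, PowerSeries.coeff_C_mul, map_ofNat,
      coeff_q₂_series]
  · rw [PowerSeries.coeff_C_mul, PowerSeries.coeff_X_pow, mul_ite, mul_one, mul_zero]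

theorem constantCoeff_q₂ (x y : ℕ) :
    MvPolynomial.constantCoeff (q₂ x y) = if x = 0 ∧ y = 0 then 1 else 0 := by
  rw [q₂, map_add, map_mul, map_mul, map_sum, Finset.sum_eq_zero, constantCoeff_q, constantCoeff_q]
  · by_cases hx : x = 0 <;> by_cases hy : y = 0 <;> simp [hx, hy]
  · intro j hj
    rw [Finset.mem_Icc] at hj
    rw [map_mul, map_mul, constantCoeff_q, if_neg (by omega), mul_zero, zero_mul]

/-- The skew-symmetric matrix `½ Q_{(x,y)}` (with `0` at `x = y = 0`). -/
def psi (x y : ℕ) : Poly := (1 / 2 : ℂ) • (q₂ x y - if x = 0 ∧ y = 0 then 1 else 0)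

theorem constantCoeff_psi (x y : ℕ) : MvPolynomial.constantCoeff (psi x y) = 0 := by
  rw [psi, MvPolynomial.constantCoeff_smul, map_sub, constantCoeff_q₂]
  split <;> simp

/-- This recursion mirrors `opH_create`. The exceptional halves at x = k, y = 0 and at x = 0 come
from Q_{(0,0)} = 1 having been removed from ψ. -/
theorem half_pderiv_psi (i x y : ℕ) : (1 / 2 : ℂ) • MvPolynomial.pderiv i (psi x y) =
    (if 2 * i + 1 ≤ x then psi (x - (2 * i + 1)) y +
      (if x = 2 * i + 1 ∧ y = 0 then (1 / 2 : ℂ) • 1 else 0)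
      else if y = 2 * i + 1 - x then
        ((-1 : ℂ) ^ (2 * i + 1 - x) * if x = 0 then 1 / 2 else 1) • 1 else 0) +
      if 2 * i + 1 ≤ y then psi x (y - (2 * i + 1)) else 0 := by
  have h1 : MvPolynomial.pderiv i (q₂ x y - if x = 0 ∧ y = 0 then 1 else 0) =
      MvPolynomial.pderiv i (q₂ x y) := by
    rw [map_sub]
    split <;> simp
  have h2 : ∀ f : Poly, 2 * f = (2 : ℂ) • f := fun f => by
    rw [MvPolynomial.smul_eq_C_mul, map_ofNat]
  have h4 : (4 * (-1) ^ (2 * i + 1 - x) : Poly) = (4 * (-1 : ℂ) ^ (2 * i + 1 - x)) • 1 := by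
    rw [MvPolynomial.smul_eq_C_mul, mul_one, map_mul, map_pow, map_neg, map_one, map_ofNat]
  rw [psi, Derivation.map_smul, h1, pderiv_q₂, psi, psi, h2, h2, h4]
  have hodd : (-1 : ℂ) ^ (2 * i + 1) = -1 := (show Odd (2 * i + 1) from ⟨i, rfl⟩).neg_one_pow
  rcases Nat.eq_zero_or_pos x with rfl | hx
  · rw [Nat.sub_zero, hodd]
    split_ifs <;> first | (exfalso; omega) | module
  · split_ifs <;> first | (exfalso; omega) | module

/-! ### Wick's theorem -/

/-- The part of the annihilation operators with which `e_0` differs from `φ_0`; it anticommutes with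
all fermions. -/
def phiTilde : Module.End ℂ Fock := (1 / 2 : ℂ) • annih 0 - create 0

theorem phi_phiTilde (n : ℤ) (v : Fock) : phi n (phiTilde v) = -phiTilde (phi n v) := by
  rcases lt_trichotomy n 0 with h | rfl | h
  · lift -n to ℕ using by omega with m hm
    obtain rfl : n = -(m : ℤ) := by omega
    have h1 := annih_annih m 0 v
    have h2 := annih_create m 0 v
    rw [if_neg (by omega)] at h2
    simp only [phiTilde, phi_neg_natCast (show 0 < m by omega), LinearMap.smul_apply,
      LinearMap.sub_apply, map_sub, map_smul]
    linear_combination (norm := module) (-1 : ℂ) ^ m • ((1 / 2 : ℂ) • h1 - h2)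
  · have h1 := annih_annih 0 0 v
    have h2 := create_create 0 0 v
    simp only [phiTilde, phi_zero, LinearMap.smul_apply, LinearMap.add_apply,
      LinearMap.sub_apply, map_sub, map_smul, map_add]
    linear_combination (norm := module) (1 / 4 : ℂ) • h1 - h2
  · lift n to ℕ using h.le
    have h1 := annih_create 0 n v
    have h2 := create_create n 0 v
    rw [if_neg (by omega)] at h1
    simp only [phiTilde, phi_natCast (show 0 < n by omega), LinearMap.smul_apply,
      LinearMap.sub_apply, map_sub, map_smul]
    linear_combination (norm := module) (1 / 2 : ℂ) • h1 - h2

theorem opH_phiTilde (i : ℕ) (v : Fock) : opH i (phiTilde v) = phiTilde (opH i v) := by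
  rw [opH, map_quadratic, quadratic_apply]
  simp only [phi_phiTilde, map_neg, neg_neg]

theorem phi_neg_odd (i : ℕ) (v : Fock) :
    phi (-(2 * (i : ℤ) + 1)) v = -annih (2 * i + 1) v := by
  have h := phi_neg_natCast (show 0 < 2 * i + 1 by omega)
  push_cast at h
  rw [h, (show Odd (2 * i + 1) from ⟨i, rfl⟩).neg_one_pow, LinearMap.smul_apply, neg_smul,
    one_smul]

/-- For y = 0, ι_0 = φ_0 + φ̃_0, and only φ_0 feels H_k. -/
theorem opH_annih (i y : ℕ) (v : Fock) :
    opH i (annih y v) = annih y (opH i v) - annih (y + (2 * i + 1)) v := by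
  rcases Nat.eq_zero_or_pos y with rfl | hy
  · have e : annih 0 = phi 0 + phiTilde := by
      rw [phi_zero, phiTilde]; module
    rw [e, LinearMap.add_apply, LinearMap.add_apply, map_add, opH_phi, opH_phiTilde, zero_sub,
      phi_neg_odd, zero_add]
    abel
  · have h := opH_phi i (-y) v
    have e : (-(y : ℤ) - (2 * i + 1)) = -((y + (2 * i + 1) : ℕ) : ℤ) := by push_cast; ring
    rw [e, phi_neg_natCast hy, phi_neg_natCast (by omega), pow_add,
      (show Odd (2 * i + 1) from ⟨i, rfl⟩).neg_one_pow] at h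
    simp only [LinearMap.smul_apply, map_smul] at h
    have h2 : ((-1 : ℂ) ^ y * (-1) ^ y) = 1 := by rw [← mul_pow]; simp
    have h3 := congrArg (fun w => (-1 : ℂ) ^ y • w) h
    simp only [smul_add, smul_smul, h2, mul_neg, mul_one, neg_smul, one_smul] at h3
    rw [h3, smul_neg, smul_smul, h2, one_smul, sub_eq_add_neg]

/-- The commutator of `H_k` with `e_x`. -/
theorem opH_create (i x : ℕ) (v : Fock) : opH i (create x v) = create x (opH i v) +
    if 2 * i + 1 ≤ x then create (x - (2 * i + 1)) v +
      (if x = 2 * i + 1 then (1 / 2 : ℂ) • annih 0 v else 0)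
    else ((-1 : ℂ) ^ (2 * i + 1 - x) * if x = 0 then 1 / 2 else 1) • annih (2 * i + 1 - x) v := by
  have hodd : (-1 : ℂ) ^ (2 * i + 1) = -1 := (show Odd (2 * i + 1) from ⟨i, rfl⟩).neg_one_pow
  rcases Nat.eq_zero_or_pos x with rfl | hx
  · have e : create 0 = phi 0 - (1 / 2 : ℂ) • annih 0 := by rw [phi_zero]; module
    rw [if_neg (by omega), if_pos rfl, Nat.sub_zero, hodd, e]
    simp only [LinearMap.sub_apply, LinearMap.smul_apply, map_sub, map_smul, opH_phi, opH_annih,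
      zero_sub, phi_neg_odd, zero_add]
    module
  · rw [← phi_natCast hx, opH_phi]
    congr 1
    by_cases h : 2 * i + 1 ≤ x
    · obtain ⟨m, rfl⟩ : ∃ m, x = m + (2 * i + 1) := ⟨x - (2 * i + 1), by omega⟩
      have e : ((m + (2 * i + 1) : ℕ) : ℤ) - (2 * i + 1) = m := by push_cast; ring
      rw [if_pos h, e, Nat.add_sub_cancel]
      -- Landing on index 0 produces φ_0 = e_0 + ½ ι_0, hence the additional term.
      rcases Nat.eq_zero_or_pos m with rfl | hm
      · rw [if_pos (by omega), Nat.cast_zero, phi_zero]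
        rfl
      · rw [if_neg (by omega), phi_natCast hm, add_zero]
    · obtain ⟨m, hm⟩ : ∃ m, 2 * i + 1 = x + m := ⟨2 * i + 1 - x, by omega⟩
      have e : (x : ℤ) - (2 * i + 1) = -(m : ℤ) := by omega
      rw [if_neg h, if_neg (by omega), e, phi_neg_natCast (by omega), hm, Nat.add_sub_cancel_left,
        mul_one, LinearMap.smul_apply]

/-- The defect in Wick's theorem for the first factor `e_x`. -/
def wickDefect (N x : ℕ) (v : Fock) : Fock :=
  create x v - ∑ y ∈ Finset.range N, raiseHom (psi x y) (annih y v)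

/-- The contraction terms of [H_k, e_x] cancel those of ½ ∂ψ, and the shift y ↦ y + k of ι_y cancels
the lowering of y in ψ. What remains are defects with v replaced by H_k v or x by x - k. -/
theorem opH_wickDefect (i N x : ℕ) {v : Fock} (hN : ∀ y, N ≤ y → annih y v = 0) :
    opH i (wickDefect N x v) = wickDefect N x (opH i v) +
      if 2 * i + 1 ≤ x then wickDefect N (x - (2 * i + 1)) v else 0 := by
  -- Reindexing by k pushes terms past N, where the contractions of v vanish.
  have hshift : ∑ y ∈ Finset.range N, raiseHom (if 2 * i + 1 ≤ y then psi x (y - (2 * i + 1)) else 0)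
      (annih y v) = ∑ y ∈ Finset.range N, raiseHom (psi x y) (annih (y + (2 * i + 1)) v) := by
    have h1 : ∑ y ∈ Finset.range N, raiseHom (if 2 * i + 1 ≤ y then psi x (y - (2 * i + 1)) else 0)
        (annih y v) = ∑ y ∈ Finset.range ((2 * i + 1) + N),
          raiseHom (if 2 * i + 1 ≤ y then psi x (y - (2 * i + 1)) else 0) (annih y v) := by
      refine Finset.sum_subset (fun y hy => ?_) fun y _ hy => ?_
      · rw [Finset.mem_range] at hy ⊢; omega
      · rw [hN y (by simpa using hy), map_zero]
    rw [h1, Finset.sum_range_add, Finset.sum_eq_zero, zero_add]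
    · refine Finset.sum_congr rfl fun y _ => ?_
      rw [if_pos (by omega), Nat.add_sub_cancel_left, add_comm y]
    · intro y hy
      rw [if_neg (by simpa using hy), map_zero, LinearMap.zero_apply]
  have hterm : ∀ y, opH i (raiseHom (psi x y) (annih y v)) =
      raiseHom (psi x y) (annih y (opH i v)) - raiseHom (psi x y) (annih (y + (2 * i + 1)) v) +
      raiseHom ((1 / 2 : ℂ) • MvPolynomial.pderiv i (psi x y)) (annih y v) := by
    intro y
    rw [opH_raiseHom, opH_annih, map_sub, map_smul, LinearMap.smul_apply]
  simp only [wickDefect, map_sub, map_sum, hterm, half_pderiv_psi, map_add, LinearMap.add_apply,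
    Finset.sum_add_distrib, Finset.sum_sub_distrib, hshift, opH_create]
  by_cases hx : 2 * i + 1 ≤ x
  · simp only [if_pos hx, map_add, LinearMap.add_apply, Finset.sum_add_distrib]
    have h : (if x = 2 * i + 1 then (1 / 2 : ℂ) • annih 0 v else 0) = ∑ y ∈ Finset.range N,
        raiseHom (if x = 2 * i + 1 ∧ y = 0 then (1 / 2 : ℂ) • 1 else 0) (annih y v) := by
      by_cases hx : x = 2 * i + 1
      · rw [Finset.sum_eq_single 0]
        · simp [hx]
        · intro y _ hy
          simp [hy]
        · intro h0
          rw [hN 0 (by simpa using h0), map_zero]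
      · simp [hx]
    rw [h]
    abel
  · simp only [if_neg hx]
    have h : ((-1 : ℂ) ^ (2 * i + 1 - x) * if x = 0 then 1 / 2 else 1) • annih (2 * i + 1 - x) v =
        ∑ y ∈ Finset.range N, raiseHom (if y = 2 * i + 1 - x then
          ((-1 : ℂ) ^ (2 * i + 1 - x) * if x = 0 then 1 / 2 else 1) • 1 else 0) (annih y v) := by
      generalize ((-1 : ℂ) ^ (2 * i + 1 - x) * if x = 0 then 1 / 2 else 1) = c
      rw [Finset.sum_eq_single (2 * i + 1 - x)]
      · simp
      · intro y _ hy
        simp [hy]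
      · intro h0
        rw [hN _ (by simpa using h0), map_zero]
    rw [h]
    abel

theorem annih_eq_zero_of_hasWeight {n : ℤ} {v : Fock} (h : HasWeight n v) {y : ℕ} (hy : n < y) :
    annih y v = 0 := eq_zero_of_hasWeight_neg (by omega) (hasWeight_annih h y)

/-- Wick's theorem: on odd vectors `e_x` acts as `∑_y ½ Q_{(x,y)} ι_y`, where polynomials act through
`γ_n / 2 ↦ -B_n / n`. -/
theorem wickDefect_eq_zero {n : ℕ} {v : Fock} (h : HasWeight n v) (hp : parity v = -v) {N : ℕ}
    (hN : n < N) (x : ℕ) : wickDefect N x v = 0 := by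
  -- Double induction on the weight of v and on x: H_k lowers one or the other. The defect is even
  -- since v is odd, and ⟨0| kills it since ψ has no constant term.
  induction n using Nat.strong_induction_on generalizing v N x with
  | _ n ihn =>
  induction x using Nat.strong_induction_on with
  | _ x ihx =>
  refine eq_zero_of_opH_eq_zero ?_ (fun i => ?_) ?_
  · simp only [wickDefect, map_sub, map_sum, parity_create, parity_raiseHom, parity_annih, hp,
      map_neg, neg_neg]
  · rw [opH_wickDefect i N x fun y hy => annih_eq_zero_of_hasWeight h (by omega)]
    have h1 : wickDefect N x (opH i v) = 0 := by
      have hw := hasWeight_opH h i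
      by_cases hi : 2 * i + 1 ≤ n
      · refine ihn (n - (2 * i + 1)) (by omega) ?_ ?_ (by omega) x
        · rwa [Nat.cast_sub hi]
        · rw [parity_opH, hp, map_neg]
      · rw [eq_zero_of_hasWeight_neg (by omega) hw]
        simp [wickDefect]
    rw [h1, zero_add]
    split
    · exact ihx _ (by omega)
    · rfl
  · simp only [wickDefect, map_sub, map_sum, leftVac_create, leftVac_raiseHom, constantCoeff_psi,
      zero_mul, Finset.sum_const_zero, sub_zero]

/-! ### From Wick's theorem to the Pfaffian -/

theorem annih_wedge (y : ℕ) (l : List ℕ) : annih y (wedge l) =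
    ∑ i : Fin l.length, (-1 : ℂ) ^ (i : ℕ) • if y = l[i] then wedge (l.eraseIdx i) else 0 := by
  induction l with
  | nil => simp [wedge_nil, annih_vac]
  | cons n l ih =>
    rw [wedge_cons, annih_create_apply, ih]
    simp only [List.length_cons, Fin.sum_univ_succ]
    rw [sub_eq_add_neg, map_sum, ← Finset.sum_neg_distrib]
    congr 1
    · simp
    · refine Finset.sum_congr rfl fun i _ => ?_
      rw [map_smul]
      by_cases h : y = l[i]
      · have h' : y = l[(i : ℕ)] := h
        simp [h', wedge_cons, pow_succ]
      · have h' : ¬ y = l[(i : ℕ)] := h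
        simp [h']

theorem raiseHom_mul_vac (f g : Poly) : raiseHom (f * g) vac = raiseHom f (raiseHom g vac) := by
  rw [map_mul, Module.End.mul_apply]

/-- The state of the Pfaffian of the `Q_{(n_i,n_j)}` is a multiple of `φ_{n₁} ⋯ φ_{n_k} |0⟩`. -/
theorem raiseHom_pfaffian (k : ℕ) {l : List ℕ} (hl : l.Pairwise (· > ·)) (hk : l.length = 2 * k) :
    raiseHom (pfaffian q₂ l) vac = (2 : ℂ) ^ k • wedge l := by
  induction k generalizing l with
  | zero =>
    obtain rfl : l = [] := List.length_eq_zero_iff.1 (by omega)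
    rw [pfaffian]
    simp [wedge_nil]
  | succ k ih =>
    rcases l with _ | ⟨x, l⟩
    · simp at hk
    rw [List.pairwise_cons] at hl
    rw [List.length_cons] at hk
    -- A decreasing list of even length has a second entry below x. So the correction at (0,0) does
    -- not affect the row of x, and ψ is exactly ½ Q there.
    have hx : x ≠ 0 := by
      rcases l with _ | ⟨y, l⟩
      · simp only [List.length_nil] at hk
        omega
      · have := hl.1 y (by simp)
        omega
    have hpsi : ∀ y, (2 : ℂ) • psi x y = q₂ x y := by
      intro y
      rw [psi, if_neg (by omega), sub_zero, smul_smul]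
      norm_num
    have hp : parity (wedge l) = -wedge l := by
      rw [parity_wedge, (show Odd l.length from ⟨k, by omega⟩).neg_one_pow, neg_one_smul]
    have hw := wickDefect_eq_zero (hasWeight_wedge l) hp (Nat.lt_succ_self _) x
    rw [wickDefect, sub_eq_zero] at hw
    -- The weight of the tail bounds each of its entries, so the cutoff in Wick's theorem loses
    -- none.
    have hi : ∀ i : Fin l.length, l[i] < l.sum.succ := fun i =>
      Nat.lt_succ_of_le (List.single_le_sum (by simp) _ (List.getElem_mem _))
    rw [pfaffian, map_sum, LinearMap.sum_apply, wedge_cons, hw, Finset.smul_sum]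
    simp only [annih_wedge, map_sum, Finset.smul_sum]
    rw [Finset.sum_comm]
    refine Finset.sum_congr rfl fun i _ => ?_
    rw [Finset.sum_eq_single l[i]]
    · rw [if_pos rfl, mul_assoc, raiseHom_mul_vac, raiseHom_mul_vac, ih (hl.2.sublist (List.eraseIdx_sublist _ _))
        (by rw [List.length_eraseIdx_of_lt i.isLt]; omega), ← hpsi, map_smul, map_smul, map_pow,
        map_neg, map_one]
      have e : ((-1 : Module.End ℂ Fock) ^ (i : ℕ)) = (-1 : ℂ) ^ (i : ℕ) • 1 := by
        rw [show (-1 : Module.End ℂ Fock) = (-1 : ℂ) • 1 by module, smul_pow, one_pow]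
      rw [e, map_smul, LinearMap.smul_apply, LinearMap.smul_apply, Module.End.one_apply, map_smul]
      module
    · intro y _ hy
      rw [if_neg hy, smul_zero, map_zero, smul_zero]
    · intro h
      exact absurd (Finset.mem_range.2 (hi i)) h

/-! ### Projective Schur functions -/

/-- The parts of a strict partition, with the part `0` added when their number is odd. -/
def StrictPartition.evenSet (lam : StrictPartition) : Finset ℕ :=
  if Odd lam.1.card then insert 0 lam.1 else lam.1

theorem StrictPartition.erase_evenSet (lam : StrictPartition) : lam.evenSet.erase 0 = lam.1 := by
  unfold evenSet
  split
  · exact Finset.erase_insert lam.2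
  · exact Finset.erase_eq_of_notMem lam.2

theorem StrictPartition.evenSet_injective {mu lam : StrictPartition} (h : mu.evenSet = lam.evenSet) :
    mu = lam := by
  apply Subtype.ext
  rw [← mu.erase_evenSet, h, lam.erase_evenSet]

theorem StrictPartition.even_card_evenSet (lam : StrictPartition) : Even lam.evenSet.card := by
  unfold evenSet
  split
  · rename_i h
    rw [Finset.card_insert_of_notMem lam.2]
    exact h.add_one
  · rename_i h
    exact Nat.not_odd_iff_even.1 h

/-- With `evenSet_injective`, strict partitions correspond to the finite sets of even cardinality,
hence to the even monomials. -/
theorem StrictPartition.exists_evenSet_eq {s : Finset ℕ} (h : Even s.card) :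
    ∃ lam : StrictPartition, lam.evenSet = s := by
  refine ⟨⟨s.erase 0, by simp⟩, ?_⟩
  unfold evenSet
  by_cases h0 : 0 ∈ s
  · have h1 := Finset.card_erase_add_one h0
    have h2 : Odd (s.erase 0).card := by
      rw [← h1, Nat.even_add_one, Nat.not_even_iff_odd] at h
      exact h
    rw [if_pos h2, Finset.insert_erase h0]
  · simp only [Finset.erase_eq_of_notMem h0]
    rw [if_neg (Nat.not_odd_iff_even.2 h)]

theorem StrictPartition.evenParts_eq (lam : StrictPartition) :
    lam.evenParts = lam.evenSet.sort (fun a b => a ≥ b) := by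
  unfold evenParts evenSet
  split
  · refine List.Perm.eq_of_pairwise (le := (· > ·)) (fun a b _ _ h1 h2 => ?_) ?_
      (sort_pairwise_gt _) ?_
    · exact absurd h1 (lt_asymm h2)
    · rw [List.pairwise_append]
      refine ⟨sort_pairwise_gt _, by simp, fun a ha b hb => ?_⟩
      rw [List.mem_singleton] at hb
      rw [Finset.mem_sort] at ha
      subst hb
      exact Nat.pos_of_ne_zero fun h0 => lam.2 (h0 ▸ ha)
    · refine (List.perm_ext_iff_of_nodup ?_ (Finset.sort_nodup _ _)).2 fun a => ?_
      · rw [List.nodup_append]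
        refine ⟨Finset.sort_nodup _ _, by simp, fun a ha b hb => ?_⟩
        rw [List.mem_singleton] at hb
        rw [Finset.mem_sort] at ha
        subst hb
        exact fun h0 => lam.2 (h0 ▸ ha)
      · simp [or_comm]
  · rw [List.append_nil]

/-- The bosonization of `Q_λ` is `2^{k/2} φ_{n₁} ⋯ φ_{n_k} |0⟩`. -/
theorem raiseHom_projSchur (lam : StrictPartition) : raiseHom (projSchur lam) vac =
    (2 : ℂ) ^ (lam.evenSet.card / 2) • monomial lam.evenSet := by
  have h := Nat.two_mul_div_two_of_even lam.even_card_evenSet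
  rw [projSchur, lam.evenParts_eq, monomial]
  exact raiseHom_pfaffian _ (sort_pairwise_gt _) (by rw [Finset.length_sort, h])

theorem parity_monomial (s : Finset ℕ) : parity (monomial s) = (-1 : ℂ) ^ s.card • monomial s := by
  rw [monomial, parity_wedge, Finset.length_sort]

/-- The Q_λ map to nonzero multiples of all even monomials, and every polynomial maps into the even
part; injectivity carries the spanning back. -/
theorem span_projSchur : Submodule.span ℂ (Set.range projSchur) = ⊤ := by
  set Φ : Poly →ₗ[ℂ] Fock := (LinearMap.applyₗ vac) ∘ₗ raiseHom.toLinearMap with hΦ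
  have hΦa : ∀ f, Φ f = raiseHom f vac := fun f => rfl
  -- v + parity v is twice the even part of v; the factor ½ is restored below by starting from ½ f.
  have hv : ∀ v : Fock, v + parity v ∈ (Submodule.span ℂ (Set.range projSchur)).map Φ := by
    intro v
    induction v using monomial_induction with
    | hzero => simp
    | hadd v w hv hw =>
      rw [map_add, add_add_add_comm]
      exact Submodule.add_mem _ hv hw
    | hsmul a v hv =>
      rw [map_smul, ← smul_add]
      exact Submodule.smul_mem _ _ hv
    | hmon s =>
      rw [parity_monomial]
      rcases Nat.even_or_odd s.card with hs | hs
      · obtain ⟨lam, rfl⟩ := StrictPartition.exists_evenSet_eq hs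
        have h1 : monomial lam.evenSet =
            Φ (((2 : ℂ) ^ (lam.evenSet.card / 2))⁻¹ • projSchur lam) := by
          rw [map_smul, hΦa, raiseHom_projSchur, smul_smul, inv_mul_cancel₀ (by simp), one_smul]
        rw [hs.neg_one_pow, one_smul, h1]
        exact Submodule.add_mem _
          (Submodule.mem_map_of_mem (Submodule.smul_mem _ _ (Submodule.subset_span ⟨lam, rfl⟩)))
          (Submodule.mem_map_of_mem (Submodule.smul_mem _ _ (Submodule.subset_span ⟨lam, rfl⟩)))
      · rw [hs.neg_one_pow, neg_smul, one_smul, add_neg_cancel]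
        exact Submodule.zero_mem _
  rw [eq_top_iff]
  intro f _
  have h := hv (Φ ((1 / 2 : ℂ) • f))
  rw [hΦa, parity_raiseHom, parity_vac, ← hΦa, ← map_add, ← add_smul] at h
  obtain ⟨g, hg, hgf⟩ := h
  have hgf' : g - f = 0 := by
    refine raiseHom_vac_injective ?_
    rw [← hΦa, map_sub, hgf, sub_eq_zero]
    norm_num
  rwa [← sub_eq_zero.1 hgf']

/-! ### The deformed scalar product -/

/-- The deformed scalar product in terms of the form on the Fock space. -/
def deformedForm (r : ℤ → ℂ) : Poly →ₗ[ℂ] Poly →ₗ[ℂ] ℂ :=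
  form.compl₁₂ ((LinearMap.applyₗ vac) ∘ₗ raiseHom.toLinearMap)
    (dilate r ∘ₗ (LinearMap.applyₗ vac) ∘ₗ raiseHom.toLinearMap)

theorem deformedForm_apply (r : ℤ → ℂ) (f g : Poly) :
    deformedForm r f g = form (raiseHom f vac) (dilate r (raiseHom g vac)) := rfl

theorem isDeformedScalarProduct_deformedForm (r : ℤ → ℂ) :
    IsDeformedScalarProduct r (deformedForm r) := by
  intro mu lam
  rw [deformedForm_apply, raiseHom_projSchur, raiseHom_projSchur, map_smul (dilate r),
    dilate_monomial, map_smul, map_smul, map_smul, LinearMap.smul_apply, form_monomial]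
  by_cases h : mu = lam
  · subst h
    rw [if_pos rfl, if_pos rfl]
    have hρ : ∏ n ∈ mu.evenSet, prodR r n = rPart r mu := by
      unfold StrictPartition.evenSet
      split
      · rw [Finset.prod_insert mu.2, prodR_zero, one_mul]; rfl
      · rfl
    have hnorm : ∏ n ∈ mu.1, genNorm n = 1 :=
      Finset.prod_eq_one fun n hn => if_neg fun h0 : n = 0 => mu.2 (h0 ▸ hn)
    -- For odd l the padding part contributes an extra 2 to the power and the norm ½ of e_0, so the
    -- result is 2^l in both cases.
    have hN : (2 : ℂ) ^ (mu.evenSet.card / 2) * (2 : ℂ) ^ (mu.evenSet.card / 2) *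
        ∏ n ∈ mu.evenSet, genNorm n = 2 ^ mu.length := by
      rw [← pow_add, ← two_mul, Nat.two_mul_div_two_of_even mu.even_card_evenSet]
      unfold StrictPartition.evenSet StrictPartition.length
      split
      · rw [Finset.prod_insert mu.2, hnorm, Finset.card_insert_of_notMem mu.2, genNorm, if_pos rfl]
        ring
      · rw [hnorm, mul_one]
    rw [hρ, ← hN]
    simp only [smul_eq_mul]
    ring
  · rw [if_neg fun e => h (StrictPartition.evenSet_injective e), if_neg h]
    simp

theorem eq_of_isDeformedScalarProduct {r : ℤ → ℂ} {b b' : Poly →ₗ[ℂ] Poly →ₗ[ℂ] ℂ}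
    (h : IsDeformedScalarProduct r b) (h' : IsDeformedScalarProduct r b') : b = b' := by
  refine LinearMap.ext_on span_projSchur ?_
  rintro _ ⟨mu, rfl⟩
  refine LinearMap.ext_on span_projSchur ?_
  rintro _ ⟨lam, rfl⟩
  rw [h mu lam, h' mu lam]

/-- Adjunction turns f(A_k/k) on the left into f(H/2) on the right, and the dilation moves through
g, turning A_k into -B_k, until it reaches the vacuum, which it fixes. -/
theorem deformedForm_eq_vev {r : ℤ → ℂ} (hr : ∀ n : ℤ, r n = r (1 - n)) (f g : Poly) :
    deformedForm r f g = vev (lowerHom f * evalHom _ (commute_neg_halfB hr) g) := by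
  rw [deformedForm_apply, form_raiseHom, form_vac, vev, Module.End.mul_apply,
    ← evalHom_neg_halfB_dilate hr, dilate_vac]

/-! ### Formal exponentials -/

theorem coeff_formalExp {σ A : Type} [Ring A] [Algebra ℂ A] (F : MvPowerSeries σ A) (α : σ →₀ ℕ) :
    MvPowerSeries.coeff α (formalExp F) = ∑ j ∈ Finset.range (α.degree + 1),
      ((j.factorial : ℂ)⁻¹) • MvPowerSeries.coeff α (F ^ j) := rfl

theorem map_coeff_formalExp {σ A C : Type} [Ring A] [Algebra ℂ A] [Ring C] [Algebra ℂ C] (M : A →ₐ[ℂ] C)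
    (F : MvPowerSeries σ A) (α : σ →₀ ℕ) : M (MvPowerSeries.coeff α (formalExp F)) =
      MvPowerSeries.coeff α (formalExp (MvPowerSeries.map (M : A →+* C) F)) := by
  rw [coeff_formalExp, coeff_formalExp, map_sum]
  refine Finset.sum_congr rfl fun j _ => ?_
  rw [map_smul, ← map_pow, MvPowerSeries.coeff_map]
  rfl

theorem map_linSeries {A C : Type} [Ring A] [Ring C] (M : A →+* C) (a : ℕ → A) :
    MvPowerSeries.map M (linSeries a) = linSeries fun i => M (a i) := by
  ext α
  rw [MvPowerSeries.coeff_map]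
  change M (∑ i ∈ α.support, _) = ∑ i ∈ α.support, _
  rw [map_sum]
  refine Finset.sum_congr rfl fun i _ => ?_
  split <;> simp

theorem neg_linSeries {A : Type} [Ring A] (a : ℕ → A) : -linSeries a = linSeries fun i => -a i := by
  ext α
  rw [map_neg]
  change -(∑ i ∈ α.support, _) = ∑ i ∈ α.support, _
  rw [← Finset.sum_neg_distrib]
  refine Finset.sum_congr rfl fun i _ => ?_
  split <;> simp

/-- Each coefficient of the exponential is a finite sum and so is respected by algebra
homomorphisms; the factor m in the exponent cancels the 1/m in the substitution. -/
theorem map_coeff_expSeries (M : Poly →ₐ[ℂ] Module.End ℂ Fock) {T : ℕ → Module.End ℂ Fock}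
    (hT : ∀ i : ℕ, (2 * (i : ℂ) + 1) • M (MvPolynomial.X i) = T i) (α : ℕ →₀ ℕ) :
    M (MvPowerSeries.coeff α expSeries) = MvPowerSeries.coeff α (formalExp (linSeries T)) := by
  rw [expSeries, map_coeff_formalExp, map_linSeries]
  congr 3
  funext i
  rw [← hT i, ← map_smul]
  rfl

theorem tau_eq_pairSeries {r : ℤ → ℂ} (hr : ∀ n : ℤ, r n = r (1 - n)) :
    tau r = pairSeries (fun f g => deformedForm r f g) expSeries expSeries := by
  have hH := map_coeff_expSeries lowerHom (T := opH) fun i => by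
    rw [lowerHom_X, smul_smul, mul_inv_cancel₀ (two_mul_add_one_ne_zero i), one_smul]
  have hB := map_coeff_expSeries (evalHom _ (commute_neg_halfB hr)) (T := fun i => -opB r i)
    fun i => by
      rw [evalHom_X, halfB, smul_neg, smul_smul, mul_inv_cancel₀ (two_mul_add_one_ne_zero i),
        one_smul]
  funext κ
  simp only [tau, pairSeries, deformedForm_eq_vev hr, hH, hB, neg_linSeries]

end BKP

end

/-! ### The theorem -/

theorem proposition5 (r : ℤ → ℂ) (hr : ∀ n : ℤ, r n = r (1 - n)) :
    (∀ i j : ℕ, Commute (BKP.opH i) (BKP.opH j)) ∧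
    (∀ i j : ℕ, Commute (BKP.opB r i) (BKP.opB r j)) ∧
    ∃ b : BKP.Poly →ₗ[ℂ] BKP.Poly →ₗ[ℂ] ℂ,
      (∀ b' : BKP.Poly →ₗ[ℂ] BKP.Poly →ₗ[ℂ] ℂ,
        BKP.IsDeformedScalarProduct r b' ↔ b' = b) ∧
      (∀ f g : BKP.Poly,
        b f g = BKP.vev (BKP.evalOp BKP.halfH f * BKP.evalOp (fun i => -BKP.halfB r i) g)) ∧
      BKP.tau r = BKP.pairSeries (fun f g => b f g) BKP.expSeries BKP.expSeries := by
  refine ⟨BKP.commute_opH, BKP.commute_opB hr, BKP.deformedForm r, fun b' => ⟨fun h => ?_, ?_⟩,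
    fun f g => ?_, BKP.tau_eq_pairSeries hr⟩
  · exact BKP.eq_of_isDeformedScalarProduct h (BKP.isDeformedScalarProduct_deformedForm r)
  · rintro rfl
    exact BKP.isDeformedScalarProduct_deformedForm r
  · rw [BKP.deformedForm_eq_vev hr, BKP.evalOp_eq BKP.commute_halfH,
      BKP.evalOp_eq (BKP.commute_neg_halfB hr)]
    rfl
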